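/- Let $(G,I,O)$ be an open graph: a finite simple graph $G=(V,E)$ with input set $I\subseteq V$ and output set $O\subseteq V$. A gflow is a pair $(g,\prec)$ of a map $g$ from $O^c$ to the subsets of $I^c$ and a strict partial order $\prec$ on $V$ such that for all $u\in O^c$: $u\prec v$ for all $v\in g(u)$; $u\in \mathrm{Odd}(g(u))$; and $u=v$ or $u\prec v$ for all $v\in \mathrm{Odd}(g(u))$, where $\mathrm{Odd}(K)$ is the set of vertices with an odd number of neighbours in $K$. Its layers are $V_k=\max_\prec\bigl(V\setminus\bigcup_{i<k}V_i\bigr)$ for $k\ge 0$, and its depth $d$ is the index of the last nonempty layer ($d=0$ if $V=\emptyset$). The gflow is maximally delayed if its depth is minimal among all gflows of $(G,I,O)$. For angles $\alpha=(\alpha_v)_{v\in O^c}$, the operation implemented by the measurement pattern is the normalization of the map $$M_\alpha=\Bigl(\bigotimes_{u\in O^c}\langle +_{\alpha_u}|\Bigr)\Bigl(\prod_{\{u,v\}\in E}\mathrm{CZ}_{u;v}\Bigr)|+\rangle_{I^c}$$ from the input qubits to the output qubits, where $|+_{\theta}\rangle=(|0\rangle+e^{i\theta}|1\rangle)/\sqrt2$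 and $|+\rangle=|+_0\rangle$. Let $\mathrm J(\theta)=\frac1{\sqrt2}\begin{pmatrix}1&e^{-i\theta}\\1&-e^{-i\theta}\end{pmatrix}$. A path cover of $(G,I,O)$ is a family of vertex-disjoint directed paths in $G$ that cover $V$, each of which meets $I$ at most in its initial point and meets $O$ exactly in its final point. **Theorem.** Let $(G,I,O)$ have a gflow $(g,\prec)$, with layers $V_k$ and depth $d$. There are a path cover of $(G,I,O)$, whose $|O|$ paths serve as the wires of a circuit, and finite sequences $U_O=U_{V_0},U_{V_1},\dots,U_{V_d}$ of two-qubit $\mathrm{CZ}$ and CNOT gates on these wires, all independent of the angles, such that distinct inputs lie on distinct wires, distinct non-outputs of the same layer lie on distinct wires, and for all real angles $\alpha$ the following holds. For $0\le k\le d$ let $\mathrm J_k$ be the layer of parallel gates that consists of one gate $\mathrm J(\alpha_v)$ on the wire of $v$ for each $v\in V_{k+1}\setminus O$; in particular $\mathrm J_d$ is empty. Then $$U=U_O\,\mathrm J_0\,U_{V_1}\,\mathrm J_1\cdots U_{V_d}\,\mathrm J_d$$ (as a product of operators, the rightmost acting first) is unitary and $$M_\alpha=2^{-|O^c|/2}\;U\,F,$$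 where $F$ places input qubit $i$ on the wire of $i$ and prepares the $|O|-|I|$ wires that carry no input in $|+\rangle$. So the circuit uses no qubits beyond the $|O|$ wires, and if $|I|=|O|$ then $F$ merely relabels the qubits and the pattern implements the unitary $U$. Moreover, if each of the $d+1$ Clifford sequences is counted as $c$ steps and each nonempty layer of parallel $\mathrm J$-gates as one step, then for every integer $c\ge 0$ the circuit has depth at most $c(d+1)+d$, with equality if the gflow is maximally delayed; in that case, the number of nonempty layers of $\mathrm J$-gates is exactly the gflow depth $d$. -/

import Mathlib

namespace MBQC

/-! ### Open graphs, generalized flow, layers -/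

/-- An open graph: a simple graph with a set of inputs and a set of outputs
(the two sets may overlap). -/
structure OpenGraph (V : Type*) where
  graph : SimpleGraph V
  inputs : Finset V
  outputs : Finset V

open Classical in
/-- The odd neighbourhood of `K`: all vertices connected to an odd number of elements of `K`. -/
def oddNbhd {V : Type*} (G : SimpleGraph V) (K : Finset V) : Set V :=
  {v | Odd (K.filter (fun w => G.Adj w v)).card}

/-- `(g, r)` is a gflow; `r u v` reads "`u ≺ v`". Only the values of `g` at non-outputs matter. -/
structure OpenGraph.IsGflow {V : Type*} (Γ : OpenGraph V)
    (g : V → Finset V) (r : V → V → Prop) : Prop where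
  irrefl : ∀ u, ¬ r u u
  trans : ∀ u v w, r u v → r v w → r u w
  not_input : ∀ u, u ∉ Γ.outputs → ∀ v ∈ g u, v ∉ Γ.inputs
  g1 : ∀ u, u ∉ Γ.outputs → ∀ v ∈ g u, r u v
  g2 : ∀ u, u ∉ Γ.outputs → u ∈ oddNbhd Γ.graph (g u)
  g3 : ∀ u, u ∉ Γ.outputs → ∀ v ∈ oddNbhd Γ.graph (g u), u = v ∨ r u v

/-- The elements of `X` that are maximal in `X` for `r`. -/
def maxSet {V : Type*} (r : V → V → Prop) (X : Set V) : Set V :=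
  {u | u ∈ X ∧ ∀ v ∈ X, ¬ r u v}

/-- The layers `V_k`: the maximal elements of what is left after removing `V_i` for all `i < k`. -/
def layer {V : Type*} (r : V → V → Prop) (k : ℕ) : Set V :=
  maxSet r {v | ∀ i : Fin k, v ∉ layer r i.val}
termination_by k
decreasing_by exact i.isLt

/-- The depth `d`: the index of the last nonempty layer, so that the layers are `V_0, …, V_d`.
(It is `0` for the empty graph.) -/
noncomputable def depth {V : Type*} (r : V → V → Prop) : ℕ :=
  sSup {k | (layer r k).Nonempty}

/-- A maximally delayed gflow: one of minimal depth. -/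
def OpenGraph.IsMaximallyDelayed {V : Type*} (Γ : OpenGraph V)
    (g : V → Finset V) (r : V → V → Prop) : Prop :=
  Γ.IsGflow g r ∧
    ∀ (g' : V → Finset V) (r' : V → V → Prop), Γ.IsGflow g' r' → depth r ≤ depth r'

/-- A path cover, given by the successor map along its paths: the paths are the orbits of `succ`.
They are vertex-disjoint (`succ_inj`), run along edges, meet the inputs at most in their initial
point (`succ_not_input`), meet the outputs exactly in their final point, and cover all vertices;
`wire v` is the final point of the path through `v`, and serves as the name of that path.
`succ` is relevant at non-outputs only. -/
structure PathCover {V : Type*} (Γ : OpenGraph V) where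
  succ : V → V
  wire : V → Γ.outputs
  succ_adj : ∀ v, v ∉ Γ.outputs → Γ.graph.Adj v (succ v)
  succ_not_input : ∀ v, v ∉ Γ.outputs → succ v ∉ Γ.inputs
  succ_inj : ∀ u v, u ∉ Γ.outputs → v ∉ Γ.outputs → succ u = succ v → u = v
  reaches : ∀ v,
    Relation.ReflTransGen (fun a b => a ∉ Γ.outputs ∧ succ a = b) v (wire v : V)

/-! ### Qubits, measurement patterns -/

/-- Labels of the computational basis of a register with one qubit for each element of `W`. -/
abbrev Bits (W : Type*) := W → Fin 2

/-- The amplitudes of `|+_θ⟩ = (|0⟩ + e^{iθ}|1⟩)/√2`. -/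
noncomputable def ketPlus (θ : ℝ) : Fin 2 → ℂ :=
  ![1 / (√2 : ℝ), Complex.exp (θ * Complex.I) / (√2 : ℝ)]

/-- The state preparation `|φ⟩_I ↦ |φ⟩_I |+⟩_{Iᶜ}`. -/
noncomputable def OpenGraph.prepare {V : Type*} [Fintype V] [DecidableEq V]
    (Γ : OpenGraph V) : Matrix (Bits V) (Bits Γ.inputs) ℂ :=
  Matrix.of fun b a =>
    if (∀ i : Γ.inputs, b i = a i) then ∏ v ∈ Γ.inputsᶜ, ketPlus 0 (b v) else 0

open Classical in
/-- The entangling operation, the product of the `CZ` gates over all edges of the graph: on a basis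
vector each edge contributes `-1` if both its end points carry a `1`, and `1` otherwise. -/
noncomputable def OpenGraph.entangle {V : Type*} [Fintype V] [DecidableEq V]
    (Γ : OpenGraph V) : Matrix (Bits V) (Bits V) ℂ :=
  Matrix.diagonal fun b => ∏ e ∈ Γ.graph.edgeFinset, if (∀ v ∈ e, b v = 1) then (-1 : ℂ) else 1

/-- The projection `⨂_{u ∉ O} ⟨+_{α_u}|` of the measured qubits. -/
noncomputable def OpenGraph.project {V : Type*} [Fintype V] [DecidableEq V]
    (Γ : OpenGraph V) (α : V → ℝ) : Matrix (Bits Γ.outputs) (Bits V) ℂ :=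
  Matrix.of fun c b =>
    if (∀ o : Γ.outputs, b o = c o) then
      ∏ u ∈ Γ.outputsᶜ, (starRingEnd ℂ) (ketPlus (α u) (b u))
    else 0

/-- The map `⨂_{u ∉ O} ⟨+_{α_u}| E_G |+⟩_{Iᶜ}` from input to output qubits, to which the operation
implemented by the measurement pattern with angles `α` is proportional. -/
noncomputable def OpenGraph.patternMap {V : Type*} [Fintype V] [DecidableEq V]
    (Γ : OpenGraph V) (α : V → ℝ) : Matrix (Bits Γ.outputs) (Bits Γ.inputs) ℂ :=
  Γ.project α * Γ.entangle * Γ.prepare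

/-! ### Circuits -/

/-- The two-qubit Clifford gates that are used, each on two different wires. -/
inductive CliffordGate (W : Type*) where
  | cz (u v : W) (h : u ≠ v) : CliffordGate W
  | cnot (control target : W) (h : control ≠ target) : CliffordGate W

/-- The unitary matrix of a two-qubit gate inside the register `W`. -/
def CliffordGate.matrix {W : Type*} [Fintype W] [DecidableEq W] :
    CliffordGate W → Matrix (Bits W) (Bits W) ℂ
  | .cz u v _ => Matrix.diagonal fun b => if b u = 1 ∧ b v = 1 then -1 else 1
  | .cnot c t _ => Matrix.of fun b a => if b = Function.update a t (a t + a c) then 1 else 0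

/-- The gate `J(θ)`. -/
noncomputable def jGate (θ : ℝ) : Matrix (Fin 2) (Fin 2) ℂ :=
  (1 / (√2 : ℝ) : ℂ) •
    !![1, Complex.exp (-(θ * Complex.I));
       1, -Complex.exp (-(θ * Complex.I))]

/-- A layer of parallel `J` gates: `J(θ)` on each wire `w` with `L w = some θ`, and nothing on each
wire `w` with `L w = none`. Its matrix is the tensor product over the wires. -/
noncomputable def jLayerMatrix {W : Type*} [Fintype W] (L : W → Option ℝ) :
    Matrix (Bits W) (Bits W) ℂ :=
  Matrix.of fun b a => ∏ w, (match L w with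
    | some θ => jGate θ
    | none => (1 : Matrix (Fin 2) (Fin 2) ℂ)) (b w) (a w)

/-- A circuit `C_0 J_0 C_1 J_1 ⋯ C_d J_d` on the wires `W` (as a product of operators, so that the
rightmost factor acts first), with sequences `C_k` of two-qubit Clifford gates and layers `J_k` of
parallel `J` gates. -/
structure LayeredCircuit (W : Type*) (d : ℕ) where
  clifford : Fin (d + 1) → List (CliffordGate W)
  jLayer : Fin (d + 1) → W → Option ℝ

/-- The operator of a layered circuit; in each list, too, the last gate acts first. -/
noncomputable def LayeredCircuit.matrix {W : Type*} [Fintype W] [DecidableEq W] {d : ℕ}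
    (C : LayeredCircuit W d) : Matrix (Bits W) (Bits W) ℂ :=
  (List.ofFn fun k : Fin (d + 1) =>
    ((C.clifford k).map CliffordGate.matrix).prod * jLayerMatrix (C.jLayer k)).prod

open Classical in
/-- The depth of a layered circuit when every Clifford sequence counts as `c` steps and every layer
that holds at least one `J` gate as one step. -/
noncomputable def LayeredCircuit.depth {W : Type*} {d : ℕ} (C : LayeredCircuit W d) (c : ℕ) : ℕ :=
  ∑ k : Fin (d + 1), (c + if ∃ w θ, C.jLayer k w = some θ then 1 else 0)

open Classical in
/-- Feeding the input state into the circuit: the input qubit `i` enters on the wire of `i`, and a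
wire without input vertex starts in `|+⟩`. If every wire carries an input vertex, this merely
relabels the qubits. -/
noncomputable def PathCover.feed {V : Type*} [Fintype V] [DecidableEq V] {Γ : OpenGraph V}
    (P : PathCover Γ) : Matrix (Bits Γ.outputs) (Bits Γ.inputs) ℂ :=
  Matrix.of fun b a =>
    if (∀ i : Γ.inputs, b (P.wire i) = a i) then
      ∏ w ∈ Finset.univ.filter (fun w : Γ.outputs => ∀ i : Γ.inputs, P.wire i ≠ w),
        ketPlus 0 (b w)
    else 0

end MBQC

/-! Expand the pattern into a sum over labels `x` of all vertices. Each edge contributes a sign and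
each measured vertex a phase. The circuit evaluates this sum one level at a time, from the inputs
down to the outputs, and its state before and after each gate layer is again a path sum: amplitudes
summed over those `x` on which `|O|` linear forms over the two-element field, one per wire, take the
values of the wire labels (`pathSum`).

Level `k` uses the space `invariantForms` of forms in the variables up to level `k` that are
invariant under translation by `g u` for all non-outputs `u` up to level `k`. Its dimension is `|O|`
on every level (`finrank_invariantForms`), and it has two adapted bases. One has the coordinate of
each level-`k` vertex on the wire of that vertex. The other has the lower neighbourhood of each
level-`(k + 1)` vertex there, or the input coordinates when `k` is the depth. A change of basis is
an invertible matrix, hence a CNOT circuit, and CZ gates then supply the edges inside the level.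

The J gates lead from the first basis on level `k + 1` to the second on level `k`
(`jLayerMatrix_mul_pathSum`). Each J gate introduces a new label coupled by a sign to the old one.
The summand is invariant under translation by `g u`, which flips exactly the lower neighbourhood
form of `u`, so the sum may be restricted to the fibre where these forms equal the new labels. The
coupling sign then becomes the CZ gates on the edges that lead down from `u`.

All ranks come from one triangularity: `g u` pairs to `1` with the lower neighbourhood of `u` and to
`0` with that of any other vertex not below `u` (`lowerNbhd_dotProduct`). With Hall's theorem it
also yields the path cover (`exists_matching`). If some level up to the depth were empty, closing
the gap would give a shallower gflow, so maximally delayed gflows fill every J layer. -/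

namespace MBQC

/-! ### Layers of a finite strict order -/

section Layers

variable {V : Type*} {r : V → V → Prop}

theorem mem_layer_iff {k : ℕ} {v : V} :
    v ∈ layer r k ↔ (∀ i < k, v ∉ layer r i) ∧ ∀ w, (∀ i < k, w ∉ layer r i) → ¬ r v w := by
  rw [layer]
  simp [maxSet, Fin.forall_iff]

theorem eq_of_mem_layer {i j : ℕ} {v : V} (hi : v ∈ layer r i) (hj : v ∈ layer r j) : i = j := by
  rcases lt_trichotomy i j with h | h | h
  · exact absurd hi ((mem_layer_iff.1 hj).1 i h)
  · exact h
  · exact absurd hj ((mem_layer_iff.1 hi).1 j h)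

theorem layer_lt_of_rel {i j : ℕ} {u v : V} (hi : u ∈ layer r i) (hj : v ∈ layer r j)
    (h : r u v) : j < i := by
  by_contra! hij
  exact (mem_layer_iff.1 hi).2 v
    (fun l hl hv => by have := eq_of_mem_layer hv hj; omega) h

theorem exists_mem_layer [Finite V] (irrefl : ∀ u, ¬ r u u)
    (trans : ∀ u v w, r u v → r v w → r u w) (v : V) : ∃ k, v ∈ layer r k := by
  have : IsTrans V (Function.swap r) := ⟨fun a b c hab hbc => trans c b a hbc hab⟩
  have : Std.Irrefl (Function.swap r) := ⟨irrefl⟩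
  have wf : WellFounded (Function.swap r) := Finite.wellFounded_of_trans_of_irrefl _
  induction v using wf.induction with
  | _ v ih =>
    choose! k hk using ih
    -- By stage `K + 1` everything above `v` has been removed, so `v` is maximal there unless it was
    -- removed earlier.
    obtain ⟨K, hK⟩ := (Set.finite_range k).bddAbove
    by_cases h : ∀ i < K + 1, v ∉ layer r i
    · refine ⟨K + 1, mem_layer_iff.2 ⟨h, fun w hw hvw => ?_⟩⟩
      exact hw (k w) (Nat.lt_succ_of_le (hK ⟨w, rfl⟩)) (hk w hvw)
    · push Not at h
      obtain ⟨i, -, hi⟩ := h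
      exact ⟨i, hi⟩

/-- Strong induction on `f v`: everything above `v` has a smaller value of `f` and is removed before
stage `f v`. This bounds the depth of an order given by a grading. -/
theorem le_of_mem_layer {f : V → ℕ} (hf : ∀ u v, r u v → f v < f u) {v : V} {j : ℕ}
    (h : v ∈ layer r j) : j ≤ f v := by
  suffices H : ∀ m, ∀ v, f v = m → ∃ i ≤ m, v ∈ layer r i by
    obtain ⟨i, hi, hv⟩ := H _ v rfl
    rwa [eq_of_mem_layer h hv]
  intro m
  induction m using Nat.strong_induction_on with
  | _ m ih =>
    intro v hv
    by_cases h : ∀ i < m, v ∉ layer r i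
    · refine ⟨m, le_rfl, mem_layer_iff.2 ⟨h, fun w hw hvw => ?_⟩⟩
      have hlt : f w < m := hv ▸ hf v w hvw
      obtain ⟨i, hi, hwi⟩ := ih _ hlt w rfl
      exact hw i (by omega) hwi
    · push Not at h
      obtain ⟨i, hi, hvi⟩ := h
      exact ⟨i, hi.le, hvi⟩

theorem depth_le {f : V → ℕ} (hf : ∀ u v, r u v → f v < f u) {d : ℕ} (hd : ∀ v, f v ≤ d) :
    depth r ≤ d :=
  csSup_le' fun _ ⟨v, hv⟩ => (le_of_mem_layer hf hv).trans (hd v)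

theorem le_depth [Finite V] {k : ℕ} {v : V} (h : v ∈ layer r k) : k ≤ depth r := by
  classical
  refine le_csSup ?_ ⟨v, h⟩
  have : Set.Finite {k | (layer r k).Nonempty} := by
    refine (Set.finite_range fun v : V => if h : ∃ k, v ∈ layer r k then h.choose else 0).subset ?_
    rintro k ⟨v, hv⟩
    have h : ∃ k, v ∈ layer r k := ⟨k, hv⟩
    exact ⟨v, by simpa [h] using eq_of_mem_layer h.choose_spec hv⟩
  exact this.bddAbove

end Layers

/-! ### Levels of a gflow -/

/-- `lev` grades the gflow `g`: the outputs have level `0`, and corrections of a vertex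
live on strictly lower levels, up to the vertex itself. -/
structure OpenGraph.IsLevelled {V : Type*} (Γ : OpenGraph V) (g : V → Finset V)
    (lev : V → ℕ) : Prop where
  eq_zero_iff : ∀ v, lev v = 0 ↔ v ∈ Γ.outputs
  not_input : ∀ u, u ∉ Γ.outputs → ∀ v ∈ g u, v ∉ Γ.inputs
  lt_of_mem : ∀ u, u ∉ Γ.outputs → ∀ v ∈ g u, lev v < lev u
  self_mem_odd : ∀ u, u ∉ Γ.outputs → u ∈ oddNbhd Γ.graph (g u)
  eq_or_lt_of_odd : ∀ u, u ∉ Γ.outputs → ∀ v ∈ oddNbhd Γ.graph (g u), u = v ∨ lev v < lev u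

section Levels

variable {V : Type*} {Γ : OpenGraph V} {g : V → Finset V} {r : V → V → Prop}

/-- The level is the layer index, except that outputs are moved to `0` even if the order puts them
deeper. Non-outputs keep a positive level: `g u` meets the neighbours of `u` oddly, so it is
nonempty and lies above `u`. -/
theorem OpenGraph.IsGflow.exists_isLevelled [Finite V] (h : Γ.IsGflow g r) :
    ∃ lev : V → ℕ, Γ.IsLevelled g lev ∧ (∀ v, lev v ≤ depth r) ∧
      ∀ k v, lev v = k + 1 ↔ v ∈ layer r (k + 1) ∧ v ∉ Γ.outputs := by
  classical
  choose l hl using exists_mem_layer h.irrefl h.trans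
  have hlt : ∀ u v, r u v → l v < l u := fun u v huv => layer_lt_of_rel (hl u) (hl v) huv
  have hpos : ∀ u, u ∉ Γ.outputs → 0 < l u := by
    intro u hu
    have hodd : Odd _ := h.g2 u hu
    obtain ⟨w, hw⟩ := Finset.card_pos.1 hodd.pos
    exact (Nat.zero_le _).trans_lt (hlt u w (h.g1 u hu w (Finset.mem_filter.1 hw).1))
  have hlt' : ∀ u v, u ∉ Γ.outputs → r u v →
      (if v ∈ Γ.outputs then 0 else l v) < if u ∈ Γ.outputs then 0 else l u := by
    intro u v hu huv
    have := hlt u v huv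
    have := hpos u hu
    simp only [hu, if_false]
    split_ifs <;> omega
  refine ⟨fun v => if v ∈ Γ.outputs then 0 else l v, ⟨?_, h.not_input, ?_, h.g2, ?_⟩, ?_, ?_⟩
  · intro v
    by_cases hv : v ∈ Γ.outputs
    · simp [hv]
    · simpa [hv] using (hpos v hv).ne'
  · exact fun u hu v hv => hlt' u v hu (h.g1 u hu v hv)
  · exact fun u hu v hv => (h.g3 u hu v hv).imp_right (hlt' u v hu)
  · intro v
    dsimp only
    split_ifs
    · exact Nat.zero_le _
    · exact le_depth (hl v)
  · intro k v
    by_cases hv : v ∈ Γ.outputs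
    · simp [hv]
    · simp only [hv, if_false, not_false_iff, and_true]
      exact ⟨fun e => e ▸ hl v, fun e => eq_of_mem_layer (hl v) e⟩

/-- If `lev` skips a value `k + 1 ≤ d`, there is a gflow of smaller depth. -/
theorem OpenGraph.IsLevelled.exists_isGflow_depth_lt {lev : V → ℕ} (h : Γ.IsLevelled g lev)
    {d k : ℕ} (hd : ∀ v, lev v ≤ d) (hk : k < d) (hskip : ∀ v, lev v ≠ k + 1) :
    ∃ r' : V → V → Prop, Γ.IsGflow g r' ∧ depth r' < d := by
  -- Levels above the gap move down by one; strict inequalities survive because the value `k + 1` is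
  -- not taken.
  set f : V → ℕ := fun v => if k + 1 < lev v then lev v - 1 else lev v with hf
  have hmono : ∀ u v, lev v < lev u → f v < f u := by
    intro u v huv
    have := hskip u
    have := hskip v
    simp only [hf]
    split_ifs <;> omega
  refine ⟨fun u v => f v < f u, ⟨fun u => lt_irrefl _, fun u v w h1 h2 => h2.trans h1,
    h.not_input, fun u hu v hv => hmono _ _ (h.lt_of_mem u hu v hv), h.self_mem_odd,
    fun u hu v hv => (h.eq_or_lt_of_odd u hu v hv).imp_right (hmono _ _)⟩, ?_⟩
  have : depth (fun u v => f v < f u) ≤ d - 1 := by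
    refine depth_le (f := f) (fun u v h => h) fun v => ?_
    have := hd v
    have := hskip v
    simp only [hf]
    split_ifs <;> omega
  omega

end Levels

end MBQC

namespace MBQC

/-! ### Lower neighbourhoods and correction sets over `ZMod 2` -/

section LowerNbhd

variable {V : Type*} [Fintype V] [DecidableEq V]

open Classical in
/-- The indicator vector of the neighbours of `v` on levels below that of `v`. -/
noncomputable def OpenGraph.lowerNbhd (Γ : OpenGraph V) (lev : V → ℕ) (v : V) : V → ZMod 2 :=
  fun w => if Γ.graph.Adj v w ∧ lev w < lev v then 1 else 0

/-- The indicator vector of a finite set. -/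
def indVec (K : Finset V) : V → ZMod 2 := fun w => if w ∈ K then 1 else 0

theorem dotProduct_indVec (φ : V → ZMod 2) (K : Finset V) : φ ⬝ᵥ indVec K = ∑ w ∈ K, φ w := by
  simp [dotProduct, indVec, Finset.sum_ite_mem]

variable {Γ : OpenGraph V} {g : V → Finset V} {lev : V → ℕ}

/-- All of `g u` lies below `v`, so the pairing is the parity of the neighbours of `v` in `g u`. The
odd neighbourhood contains `u`, and its other elements are strictly lower than `u`. -/
theorem OpenGraph.IsLevelled.lowerNbhd_dotProduct (h : Γ.IsLevelled g lev) {u v : V}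
    (hu : u ∉ Γ.outputs) (huv : lev u ≤ lev v) :
    Γ.lowerNbhd lev v ⬝ᵥ indVec (g u) = if v = u then 1 else 0 := by
  classical
  have key : Γ.lowerNbhd lev v ⬝ᵥ indVec (g u)
      = (((g u).filter fun w => Γ.graph.Adj w v).card : ZMod 2) := by
    rw [dotProduct_indVec, Finset.natCast_card_filter]
    refine Finset.sum_congr rfl fun w hw => ?_
    have : lev w < lev v := (h.lt_of_mem u hu w hw).trans_le huv
    simp [OpenGraph.lowerNbhd, this, Γ.graph.adj_comm]
  have hmem : v ∈ oddNbhd Γ.graph (g u) ↔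
      Odd ((g u).filter fun w => Γ.graph.Adj w v).card := by
    simp only [oddNbhd, Set.mem_ofPred_eq]
  rw [key]
  by_cases hodd : v ∈ oddNbhd Γ.graph (g u)
  · have huv' : v = u := by
      rcases h.eq_or_lt_of_odd u hu v hodd with e | e
      · exact e.symm
      · omega
    rw [if_pos huv', ZMod.natCast_eq_one_iff_odd]
    exact hmem.1 hodd
  · have huv' : v ≠ u := fun e => hodd (e ▸ h.self_mem_odd u hu)
    rw [if_neg huv', ZMod.natCast_eq_zero_iff_even, ← Nat.not_odd_iff_even]
    exact fun e => hodd (hmem.2 e)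

/-- The lower neighbourhoods of non-outputs are independent, even on the non-inputs alone. -/
theorem OpenGraph.IsLevelled.eq_zero_of_sum_lowerNbhd (h : Γ.IsLevelled g lev)
    (S : Finset V) (hS : ∀ v ∈ S, v ∉ Γ.outputs) (c : V → ZMod 2)
    (hc : ∀ w, w ∉ Γ.inputs → ∑ v ∈ S, c v * Γ.lowerNbhd lev v w = 0) : ∀ v ∈ S, c v = 0 := by
  suffices H : ∀ m, ∀ v ∈ S, lev v = m → c v = 0 from fun v hv => H _ v hv rfl
  intro m
  induction m using Nat.strong_induction_on with
  | _ m ih =>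
    intro u hu hum
    -- Pair the relation with `g u`, which avoids the inputs. Lower terms vanish by induction and
    -- the remaining ones with `v ≠ u` by triangularity.
    have h1 : ∑ v ∈ S, c v * (Γ.lowerNbhd lev v ⬝ᵥ indVec (g u)) = 0 := by
      have : ∀ w ∈ g u, ∑ v ∈ S, c v * Γ.lowerNbhd lev v w = 0 :=
        fun w hw => hc w (h.not_input u (hS u hu) w hw)
      simp_rw [dotProduct_indVec, Finset.mul_sum]
      rw [Finset.sum_comm]
      exact Finset.sum_eq_zero this
    rw [Finset.sum_eq_single_of_mem u hu] at h1
    · simpa [h.lowerNbhd_dotProduct (hS u hu) le_rfl] using h1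
    · intro v hv hvu
      by_cases hlt : lev v < lev u
      · rw [ih _ (hum ▸ hlt) v hv rfl, zero_mul]
      · rw [h.lowerNbhd_dotProduct (hS u hu) (not_lt.1 hlt), if_neg hvu, mul_zero]

/-- Non-outputs can be matched to distinct non-inputs among their neighbours on lower levels. -/
theorem OpenGraph.IsLevelled.exists_matching (h : Γ.IsLevelled g lev) :
    ∃ s : {v // v ∉ Γ.outputs} → V, Function.Injective s ∧
      ∀ v, s v ∉ Γ.inputs ∧ Γ.graph.Adj v (s v) ∧ lev (s v) < lev v := by
  classical
  let t : {v // v ∉ Γ.outputs} → Finset V := fun v =>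
    Finset.univ.filter fun w => w ∉ Γ.inputs ∧ Γ.graph.Adj v w ∧ lev w < lev v
  obtain ⟨s, hs, hst⟩ := (Finset.all_card_le_biUnion_card_iff_exists_injective t).1 (by
    intro S
    -- Hall's condition is a rank bound: the lower neighbourhoods of `S` stay independent when
    -- restricted to the candidates for `S`. At any other non-input they all vanish, so nothing is
    -- lost.
    have hli : LinearIndependent (ZMod 2)
        (fun v : S => fun w : S.biUnion t => Γ.lowerNbhd lev v.1.1 w.1) := by
      rw [Fintype.linearIndependent_iff]
      intro c hc v
      let c' : V → ZMod 2 := fun x => if hx : ∃ y : S, y.1.1 = x then c hx.choose else 0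
      have hc' : ∀ y : S, c' y.1.1 = c y := by
        intro y
        have hx : ∃ y' : S, y'.1.1 = y.1.1 := ⟨y, rfl⟩
        simp only [c', dif_pos hx]
        congr 1
        exact Subtype.ext (Subtype.ext hx.choose_spec)
      have hsum : ∀ f : V → ZMod 2,
          ∑ x ∈ S.map (Function.Embedding.subtype _), f x = ∑ y : S, f y.1.1 := by
        intro f
        rw [Finset.sum_map, ← Finset.sum_coe_sort]
        rfl
      have := h.eq_zero_of_sum_lowerNbhd (S.map (Function.Embedding.subtype _))
        (by simp +contextual) c' (by
          intro w hw
          rw [hsum]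
          by_cases hwt : w ∈ S.biUnion t
          · have := congrFun hc ⟨w, hwt⟩
            simpa [hc'] using this
          · refine Finset.sum_eq_zero fun y _ => ?_
            have : ¬ (Γ.graph.Adj y.1.1 w ∧ lev w < lev y.1.1) := fun hh =>
              hwt (Finset.mem_biUnion.2 ⟨y.1, y.2, by simpa [t] using ⟨hw, hh⟩⟩)
            simp [OpenGraph.lowerNbhd, this])
      rw [← hc']
      exact this _ (Finset.mem_map_of_mem _ v.2)
    have := hli.fintype_card_le_finrank
    rwa [Module.finrank_fintype_fun_eq_card, Fintype.card_coe, Fintype.card_coe] at this)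
  exact ⟨s, hs, fun v => by simpa [t] using hst v⟩

end LowerNbhd

/-! ### Path covers along which the level decreases -/

section PathCover

variable {V : Type*} {Γ : OpenGraph V}

theorem PathCover.wire_output (P : PathCover Γ) (o : Γ.outputs) : P.wire o = o := by
  rcases (P.reaches o).cases_head with h | ⟨_, ⟨h, -⟩, -⟩
  · exact Subtype.ext h.symm
  · exact absurd o.2 h

/-- Followed backwards from their common output, the two paths agree as long as both last, since
predecessors are unique. -/
theorem PathCover.reaches_total (P : PathCover Γ) {u v : V} (h : P.wire u = P.wire v) :
    Relation.ReflTransGen (fun a b => a ∉ Γ.outputs ∧ P.succ a = b) u v ∨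
      Relation.ReflTransGen (fun a b => a ∉ Γ.outputs ∧ P.succ a = b) v u := by
  have hu := Relation.reflTransGen_swap.2 (P.reaches u)
  have hv := Relation.reflTransGen_swap.2 (P.reaches v)
  rw [← h] at hv
  have := Relation.ReflTransGen.total_of_right_unique (by
    rintro a b c ⟨hb, rfl⟩ ⟨hc, hcb⟩
    exact P.succ_inj _ _ hb hc hcb.symm) hu hv
  exact (this.imp Relation.reflTransGen_swap.1 Relation.reflTransGen_swap.1).symm

theorem PathCover.wire_injOn_inputs (P : PathCover Γ) : Set.InjOn P.wire ↑Γ.inputs := by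
  have key : ∀ u v, v ∈ Γ.inputs →
      Relation.ReflTransGen (fun a b => a ∉ Γ.outputs ∧ P.succ a = b) u v → u = v := by
    intro u v hv h
    rcases h.cases_tail with e | ⟨w, -, hw, rfl⟩
    · exact e.symm
    · exact absurd hv (P.succ_not_input w hw)
  intro u hu v hv h
  rcases P.reaches_total h with h | h
  · exact key u v hv h
  · exact (key v u hu h).symm

theorem PathCover.wire_injOn_level (P : PathCover Γ) {lev : V → ℕ}
    (hlev : ∀ v, v ∉ Γ.outputs → lev (P.succ v) < lev v) (k : ℕ) :
    Set.InjOn P.wire {v | lev v = k} := by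
  have key : ∀ u v, Relation.ReflTransGen (fun a b => a ∉ Γ.outputs ∧ P.succ a = b) u v →
      u = v ∨ lev v < lev u := by
    intro u v h
    induction h with
    | refl => exact Or.inl rfl
    | tail _ hbc ih =>
      obtain ⟨hb, rfl⟩ := hbc
      right
      rcases ih with rfl | ih
      · exact hlev _ hb
      · exact (hlev _ hb).trans ih
  intro u hu v hv h
  simp only [Set.mem_ofPred_eq] at hu hv
  rcases P.reaches_total h with h | h
  · rcases key u v h with e | e
    · exact e
    · omega
  · rcases key v u h with e | e
    · exact e.symm
    · omega

theorem OpenGraph.IsLevelled.exists_pathCover [Fintype V] [DecidableEq V] {g : V → Finset V}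
    {lev : V → ℕ} (h : Γ.IsLevelled g lev) :
    ∃ P : PathCover Γ, ∀ v, v ∉ Γ.outputs → lev (P.succ v) < lev v := by
  obtain ⟨s, hs, hs'⟩ := h.exists_matching
  let σ : V → V := fun v => if hv : v ∉ Γ.outputs then s ⟨v, hv⟩ else v
  have hσ : ∀ v (hv : v ∉ Γ.outputs), σ v = s ⟨v, hv⟩ := fun v hv => by simp [σ, hv]
  have hreach : ∀ m, ∀ v, lev v = m → ∃ o : Γ.outputs,
      Relation.ReflTransGen (fun a b => a ∉ Γ.outputs ∧ σ a = b) v o := by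
    intro m
    induction m using Nat.strong_induction_on with
    | _ m ih =>
      intro v hv
      by_cases hvO : v ∈ Γ.outputs
      · exact ⟨⟨v, hvO⟩, .refl⟩
      · obtain ⟨o, ho⟩ := ih (lev (σ v)) (by rw [← hv, hσ v hvO]; exact (hs' ⟨v, hvO⟩).2.2) _ rfl
        exact ⟨o, .head ⟨hvO, rfl⟩ ho⟩
  choose wire hwire using fun v => hreach _ v rfl
  refine ⟨⟨σ, wire, ?_, ?_, ?_, hwire⟩, ?_⟩
  · intro v hv; rw [hσ v hv]; exact (hs' ⟨v, hv⟩).2.1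
  · intro v hv; rw [hσ v hv]; exact (hs' ⟨v, hv⟩).1
  · intro u v hu hv e
    rw [hσ u hu, hσ v hv] at e
    exact congrArg Subtype.val (hs e)
  · intro v hv
    change lev (σ v) < lev v
    rw [hσ v hv]; exact (hs' ⟨v, hv⟩).2.2

end PathCover

end MBQC

namespace MBQC

/-! ### Families of linear forms, indexed by wires -/

section Glue

variable {V W M : Type*}

open Classical in
/-- The family that equals `z v` on the wire of `v ∈ L` and `κ w` on each other wire `w`. -/
noncomputable def glue (L : Finset V) (wire : V → W) (z : V → M) (κ : W → M) (w : W) : M :=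
  if h : ∃ v ∈ L, wire v = w then z h.choose else κ w

theorem glue_wire {L : Finset V} {wire : V → W} (hw : Set.InjOn wire L) (z : V → M) (κ : W → M)
    {v : V} (hv : v ∈ L) : glue L wire z κ (wire v) = z v := by
  have h : ∃ v' ∈ L, wire v' = wire v := ⟨v, hv, rfl⟩
  rw [glue, dif_pos h, hw h.choose_spec.1 hv h.choose_spec.2]

theorem glue_of_ne {L : Finset V} {wire : V → W} (z : V → M) (κ : W → M)
    {w : W} (h : ∀ v ∈ L, wire v ≠ w) : glue L wire z κ w = κ w := by
  rw [glue, dif_neg]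
  rintro ⟨v, hv, e⟩
  exact h v hv e

theorem glue_cases {L : Finset V} {wire : V → W} (z : V → M) (κ : W → M) {p : M → Prop}
    (hz : ∀ v ∈ L, p (z v)) (hκ : ∀ w, (∀ v ∈ L, wire v ≠ w) → p (κ w)) (w : W) :
    p (glue L wire z κ w) := by
  rw [glue]
  split_ifs with h
  · exact hz _ h.choose_spec.1
  · exact hκ w fun v hv e => h ⟨v, hv, e⟩

end Glue

section Forms

variable {V W F : Type*} [Fintype V] [DecidableEq V] [Field F]

/-- The vectors that are orthogonal to `a v` for all `v ∈ L`. -/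
def orth (L : Finset V) (a : V → V → F) : Submodule F (V → F) where
  carrier := {φ | ∀ v ∈ L, a v ⬝ᵥ φ = 0}
  add_mem' h1 h2 v hv := by rw [dotProduct_add, h1 v hv, h2 v hv, add_zero]
  zero_mem' v _ := dotProduct_zero _
  smul_mem' c φ h v hv := by rw [dotProduct_smul, h v hv, smul_zero]

omit [DecidableEq V] in
theorem mem_orth {L : Finset V} {a : V → V → F} {φ : V → F} :
    φ ∈ orth L a ↔ ∀ v ∈ L, a v ⬝ᵥ φ = 0 := Iff.rfl

/-- Pairing a relation with `a v` isolates the coefficient on the wire of `v`; what remains is a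
relation among the `κ w`. -/
theorem linearIndependent_glue [Fintype W] {L : Finset V} {wire : V → W}
    (hw : Set.InjOn wire L) {a z : V → V → F} {κ : W → V → F}
    (hdual : ∀ v ∈ L, ∀ v' ∈ L, a v ⬝ᵥ z v' = if v = v' then 1 else 0)
    (hκ : ∀ w, (∀ v ∈ L, wire v ≠ w) → κ w ∈ orth L a)
    (hli : LinearIndependent F fun w : {w // ∀ v ∈ L, wire v ≠ w} => κ w) :
    LinearIndependent F (glue L wire z κ) := by
  classical
  rw [Fintype.linearIndependent_iff]
  intro c hc
  have h1 : ∀ v ∈ L, c (wire v) = 0 := by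
    intro v hv
    have h := congrArg (fun φ => a v ⬝ᵥ φ) hc
    simp only [dotProduct_zero, dotProduct_sum, dotProduct_smul, smul_eq_mul] at h
    rw [Finset.sum_eq_single_of_mem (wire v) (Finset.mem_univ _)] at h
    · simpa [glue_wire hw z κ hv, hdual v hv v hv] using h
    · intro w _ hne
      by_cases hw' : ∃ v' ∈ L, wire v' = w
      · obtain ⟨v', hv', rfl⟩ := hw'
        have : v ≠ v' := fun e => hne (e ▸ rfl)
        rw [glue_wire hw z κ hv', hdual v hv v' hv', if_neg this, mul_zero]
      · push Not at hw'
        rw [glue_of_ne z κ hw', hκ w hw' v hv, mul_zero]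
  have h2 : ∑ w : {w // ∀ v ∈ L, wire v ≠ w}, c w • κ w = 0 := by
    rw [← hc, ← Finset.sum_subtype (Finset.univ.filter fun w => ∀ v ∈ L, wire v ≠ w) (by simp)
      fun w => c w • κ w, Finset.sum_filter]
    refine Finset.sum_congr rfl fun w _ => ?_
    split_ifs with hw'
    · rw [glue_of_ne z κ hw']
    · push Not at hw'
      obtain ⟨v, hv, rfl⟩ := hw'
      rw [h1 v hv, zero_smul]
  intro w
  by_cases hw' : ∀ v ∈ L, wire v ≠ w
  · exact Fintype.linearIndependent_iff.1 hli _ h2 ⟨w, hw'⟩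
  · push Not at hw'
    obtain ⟨v, hv, rfl⟩ := hw'
    exact h1 v hv

/-- Rank-nullity for the pairings with all `a v`: the dual vectors `z v` make this map surjective on
`S`. -/
theorem finrank_inf_orth (S : Submodule F (V → F)) {L : Finset V} {a z : V → V → F}
    (hz : ∀ v ∈ L, z v ∈ S)
    (hdual : ∀ v ∈ L, ∀ v' ∈ L, a v ⬝ᵥ z v' = if v = v' then 1 else 0) :
    Module.finrank F ↥(S ⊓ orth L a) + L.card = Module.finrank F S := by
  let f : S →ₗ[F] (L → F) := (Matrix.mulVecLin (Matrix.of fun v : L => a v)).domRestrict S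
  have hf : ∀ φ : S, ∀ v : L, f φ v = a v ⬝ᵥ φ := fun φ v => rfl
  have hrange : LinearMap.range f = ⊤ := by
    rw [LinearMap.range_eq_top]
    intro y
    refine ⟨∑ v : L, y v • ⟨z v, hz v v.2⟩, ?_⟩
    rw [map_sum]
    ext u
    simp only [map_smul, Finset.sum_apply, Pi.smul_apply, hf, smul_eq_mul]
    rw [Finset.sum_eq_single_of_mem u (Finset.mem_univ _)]
    · simp [hdual u u.2 u u.2]
    · intro v _ hvu
      rw [hdual u u.2 v v.2, if_neg (fun e => hvu (Subtype.ext e.symm)), mul_zero]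
  have hker : (LinearMap.ker f).map S.subtype = S ⊓ orth L a := by
    ext φ
    simp only [Submodule.mem_map, LinearMap.mem_ker, Submodule.mem_inf, mem_orth]
    constructor
    · rintro ⟨ψ, hψ, rfl⟩
      exact ⟨ψ.2, fun v hv => congrFun hψ ⟨v, hv⟩⟩
    · rintro ⟨h1, h2⟩
      exact ⟨⟨φ, h1⟩, funext fun v => h2 v v.2, rfl⟩
  have := f.finrank_range_add_finrank_ker
  rw [hrange, finrank_top, Module.finrank_fintype_fun_eq_card, Fintype.card_coe] at this
  rw [← hker, LinearEquiv.finrank_eq (Submodule.equivSubtypeMap _ _).symm] at *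
  omega

/-- A submodule of the right dimension has a basis that completes a family on some wires. -/
theorem exists_family_on_other_wires [Fintype W] (K : Submodule F (V → F)) {L : Finset V}
    {wire : V → W} (hw : Set.InjOn wire L)
    (hK : Module.finrank F K + L.card = Fintype.card W) :
    ∃ κ : W → V → F, (∀ w, κ w ∈ K) ∧
      LinearIndependent F fun w : {w // ∀ v ∈ L, wire v ≠ w} => κ w := by
  classical
  have hcard : Fintype.card {w // ∀ v ∈ L, wire v ≠ w} = Module.finrank F K := by
    have h1 : Fintype.card {w // ¬ ∀ v ∈ L, wire v ≠ w} = L.card := by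
      rw [Fintype.card_subtype, ← Finset.card_image_of_injOn hw]
      congr 1
      ext w
      simp
    have := Fintype.card_subtype_compl (fun w => ∀ v ∈ L, wire v ≠ w)
    have := Fintype.card_subtype_le (fun w => ∀ v ∈ L, wire v ≠ w)
    omega
  let e := (Module.finBasisOfFinrankEq F K hcard.symm).reindex (Fintype.equivFin _).symm
  refine ⟨fun w => if h : ∀ v ∈ L, wire v ≠ w then e ⟨w, h⟩ else 0, fun w => ?_, ?_⟩
  · dsimp only
    split_ifs
    · exact (e _).2
    · exact K.zero_mem
  · have := e.linearIndependent.map' K.subtype (Submodule.ker_subtype K)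
    have he : (fun w : {w // ∀ v ∈ L, wire v ≠ w} =>
        if h : ∀ v ∈ L, wire v ≠ w then (e ⟨w, h⟩ : V → F) else 0) = K.subtype ∘ e :=
      funext fun w => dif_pos w.2
    rw [he]
    exact this

omit [DecidableEq V] in
theorem exists_change_of_basis [Fintype W] [DecidableEq W] {S : Submodule F (V → F)}
    (hS : Module.finrank F S = Fintype.card W) {b c : W → V → F} (hb : LinearIndependent F b)
    (hc : LinearIndependent F c) (hbS : ∀ w, b w ∈ S) (hcS : ∀ w, c w ∈ S) :
    ∃ G : Matrix W W F, G.det ≠ 0 ∧ ∀ w, b w = ∑ w', G w w' • c w' := by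
  have key : ∀ b : W → V → F, LinearIndependent F b → (∀ w, b w ∈ S) →
      ∃ B : Module.Basis W F S, ∀ w, (B w : V → F) = b w := by
    intro b hb hbS
    have hb' : LinearIndependent F fun w => (⟨b w, hbS w⟩ : S) :=
      LinearIndependent.of_comp S.subtype hb
    rcases isEmpty_or_nonempty W with hW | hW
    · have : Module.finrank F S = 0 := by simpa using hS
      have := Module.finrank_zero_iff.1 this
      exact ⟨Module.Basis.empty _, fun w => isEmptyElim w⟩
    · exact ⟨basisOfLinearIndependentOfCardEqFinrank hb' hS.symm, by simp⟩
  obtain ⟨B, hB⟩ := key b hb hbS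
  obtain ⟨C, hC⟩ := key c hc hcS
  refine ⟨(C.toMatrix B).transpose, ?_, fun w => ?_⟩
  · rw [Matrix.det_transpose]
    have := Matrix.isUnit_det_of_right_inverse (C.toMatrix_mul_toMatrix_flip B)
    exact this.ne_zero
  · have := congrArg Subtype.val (C.sum_toMatrix_smul_self B w)
    rw [hB] at this
    rw [← this, Submodule.coe_sum]
    exact Finset.sum_congr rfl fun w' _ => by rw [Submodule.coe_smul, hC, Matrix.transpose_apply]

end Forms

/-! ### The space of invariant forms on each level -/

section LevelForms

variable {V : Type*} [Fintype V] [DecidableEq V] {Γ : OpenGraph V} {g : V → Finset V}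
  {lev : V → ℕ}

/-- The vertices on level `k`. -/
def levelSet (lev : V → ℕ) (k : ℕ) : Finset V := Finset.univ.filter fun v => lev v = k

omit [DecidableEq V] in
@[simp] theorem mem_levelSet {k : ℕ} {v : V} : v ∈ levelSet lev k ↔ lev v = k := by
  simp [levelSet]

/-- The linear forms in the variables up to level `k` that are invariant under the translations
along the correction sets of the vertices up to level `k`. -/
def invariantForms (Γ : OpenGraph V) (g : V → Finset V) (lev : V → ℕ) (k : ℕ) :
    Submodule (ZMod 2) (V → ZMod 2) :=
  orth (Finset.univ.filter fun v => k < lev v) (fun v => Pi.single v 1) ⊓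
    orth (Finset.univ.filter fun u => u ∉ Γ.outputs ∧ lev u ≤ k) fun u => indVec (g u)

theorem mem_invariantForms {k : ℕ} {φ : V → ZMod 2} : φ ∈ invariantForms Γ g lev k ↔
    (∀ v, k < lev v → φ v = 0) ∧ ∀ u, u ∉ Γ.outputs → lev u ≤ k → indVec (g u) ⬝ᵥ φ = 0 := by
  simp [invariantForms, mem_orth]

theorem single_dual (L : Finset V) : ∀ v ∈ L, ∀ v' ∈ L,
    (Pi.single v 1 : V → ZMod 2) ⬝ᵥ Pi.single v' 1 = if v = v' then 1 else 0 := by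
  intro v _ v' _
  simp [Pi.single_apply, eq_comm]

namespace OpenGraph.IsLevelled


omit [Fintype V] [DecidableEq V] in
theorem not_output (h : Γ.IsLevelled g lev) {k : ℕ} {v : V} (hv : lev v = k + 1) :
    v ∉ Γ.outputs := by
  rw [← h.eq_zero_iff]; omega

theorem single_mem_invariantForms {k : ℕ} {v : V} (hv : lev v ≤ k)
    (hv' : ∀ u, u ∉ Γ.outputs → lev u ≤ k → v ∉ g u) :
    Pi.single v 1 ∈ invariantForms Γ g lev k := by
  rw [mem_invariantForms]
  refine ⟨fun w hw => ?_, fun u hu huk => ?_⟩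
  · rw [Pi.single_apply, if_neg]
    rintro rfl
    omega
  · simp [indVec, hv' u hu huk]

theorem single_level_mem (h : Γ.IsLevelled g lev) (k : ℕ) : ∀ v ∈ levelSet lev k,
    Pi.single v 1 ∈ invariantForms Γ g lev k := by
  intro v hv
  rw [mem_levelSet] at hv
  refine single_mem_invariantForms hv.le fun u hu huk hvu => ?_
  have := h.lt_of_mem u hu v hvu
  omega

theorem lowerNbhd_mem (h : Γ.IsLevelled g lev) (k : ℕ) : ∀ v ∈ levelSet lev (k + 1),
    Γ.lowerNbhd lev v ∈ invariantForms Γ g lev k := by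
  intro v hv
  rw [mem_levelSet] at hv
  rw [mem_invariantForms]
  refine ⟨fun w hw => ?_, fun u hu huk => ?_⟩
  · rw [OpenGraph.lowerNbhd, if_neg]
    omega
  · rw [dotProduct_comm, h.lowerNbhd_dotProduct hu (by omega), if_neg]
    rintro rfl
    omega

theorem indVec_dual (h : Γ.IsLevelled g lev) (k : ℕ) : ∀ u ∈ levelSet lev (k + 1), ∀ v ∈ levelSet lev (k + 1),
    indVec (g u) ⬝ᵥ Γ.lowerNbhd lev v = if u = v then 1 else 0 := by
  intro u hu v hv
  rw [mem_levelSet] at hu hv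
  rw [dotProduct_comm, h.lowerNbhd_dotProduct (h.not_output hu) (by omega)]
  simp [eq_comm]

/-- The forms common to both levels. They are what the wires without a J gate carry, and comparing
codimensions in the two spaces shows that the dimension is constant. -/
theorem invariantForms_inf_orth (h : Γ.IsLevelled g lev) (k : ℕ) :
    invariantForms Γ g lev (k + 1) ⊓ orth (levelSet lev (k + 1)) (fun v => Pi.single v 1) =
      invariantForms Γ g lev k ⊓ orth (levelSet lev (k + 1)) fun u => indVec (g u) := by
  ext φ
  simp only [Submodule.mem_inf, mem_invariantForms, mem_orth, mem_levelSet, single_dotProduct,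
    one_mul]
  constructor
  · rintro ⟨⟨h1, h2⟩, h3⟩
    refine ⟨⟨fun v hv => ?_, fun u hu huk => h2 u hu (by omega)⟩,
      fun u hu => h2 u (h.not_output hu) hu.le⟩
    rcases Nat.lt_or_ge (k + 1) (lev v) with hv' | hv'
    · exact h1 v hv'
    · exact h3 v (by omega)
  · rintro ⟨⟨h1, h2⟩, h3⟩
    refine ⟨⟨fun v hv => h1 v (by omega), fun u hu huk => ?_⟩, fun v hv => h1 v (by omega)⟩
    rcases Nat.lt_or_ge k (lev u) with hu' | hu'
    · exact h3 u (by omega)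
    · exact h2 u hu hu'

/-- On level `0` there are no correction sets to respect, so every form in the output variables
qualifies. For the step, the spaces on levels `k` and `k + 1` both exceed their common part by the
number of vertices on level `k + 1`. -/
theorem finrank_invariantForms (h : Γ.IsLevelled g lev) (k : ℕ) :
    Module.finrank (ZMod 2) (invariantForms Γ g lev k) = Γ.outputs.card := by
  induction k with
  | zero =>
    have h1 := finrank_inf_orth _ (h.single_level_mem 0) (single_dual _)
    have h2 : invariantForms Γ g lev 0 ⊓ orth (levelSet lev 0) (fun v => Pi.single v 1) = ⊥ := by
      rw [eq_bot_iff]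
      intro φ hφ
      simp only [Submodule.mem_inf, mem_invariantForms, mem_orth, mem_levelSet,
        single_dotProduct, one_mul] at hφ
      rw [Submodule.mem_bot]
      ext v
      rcases Nat.eq_zero_or_pos (lev v) with hv | hv
      · exact hφ.2 v hv
      · exact hφ.1.1 v hv
    have h3 : levelSet lev 0 = Γ.outputs := by
      ext v
      rw [mem_levelSet, h.eq_zero_iff]
    rw [h2, finrank_bot, h3] at h1
    omega
  | succ k ih =>
    have h1 := finrank_inf_orth _ (h.single_level_mem (k + 1)) (single_dual _)
    have h2 := finrank_inf_orth _ (h.lowerNbhd_mem k) (h.indVec_dual k)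
    rw [h.invariantForms_inf_orth] at h1
    omega

/-- Bases of the invariant forms on the levels `k` and `k + 1` that differ only on the wires of
the vertices on level `k + 1`. -/
theorem exists_level_family (h : Γ.IsLevelled g lev) {wire : V → Γ.outputs} (k : ℕ)
    (hw : Set.InjOn wire (levelSet lev (k + 1))) :
    ∃ κ : Γ.outputs → V → ZMod 2,
      (∀ w, κ w ∈ invariantForms Γ g lev k) ∧
      (∀ w, κ w ∈ invariantForms Γ g lev (k + 1)) ∧
      LinearIndependent (ZMod 2)
        (glue (levelSet lev (k + 1)) wire (fun v => Pi.single v 1) κ) ∧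
      LinearIndependent (ZMod 2)
        (glue (levelSet lev (k + 1)) wire (Γ.lowerNbhd lev) κ) := by
  obtain ⟨κ, hκ, hli⟩ := exists_family_on_other_wires
    (invariantForms Γ g lev k ⊓ orth (levelSet lev (k + 1)) fun u => indVec (g u)) hw (by
      rw [finrank_inf_orth _ (h.lowerNbhd_mem k) (h.indVec_dual k), h.finrank_invariantForms]
      simp)
  have hκ' := hκ
  rw [← h.invariantForms_inf_orth] at hκ'
  exact ⟨κ, fun w => (hκ w).1, fun w => (hκ' w).1,
    linearIndependent_glue hw (single_dual _) (fun w _ => (hκ' w).2) hli,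
    linearIndependent_glue hw (h.indVec_dual k) (fun w _ => (hκ w).2) hli⟩

theorem single_input_mem (h : Γ.IsLevelled g lev) {d : ℕ} (hd : ∀ v, lev v ≤ d) :
    ∀ v ∈ Γ.inputs, Pi.single v 1 ∈ invariantForms Γ g lev d :=
  fun v hv => single_mem_invariantForms (hd v) fun u hu _ hvu => h.not_input u hu v hvu hv

theorem exists_input_family (h : Γ.IsLevelled g lev) {wire : V → Γ.outputs} (hw : Set.InjOn wire Γ.inputs) {d : ℕ}
    (hd : ∀ v, lev v ≤ d) :
    ∃ κ : Γ.outputs → V → ZMod 2,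
      (∀ w, κ w ∈ invariantForms Γ g lev d) ∧
      LinearIndependent (ZMod 2) (glue Γ.inputs wire (fun v => Pi.single v 1) κ) := by
  obtain ⟨κ, hκ, hli⟩ := exists_family_on_other_wires
    (invariantForms Γ g lev d ⊓ orth Γ.inputs fun v => Pi.single v 1) hw (by
      rw [finrank_inf_orth _ (h.single_input_mem hd) (single_dual _), h.finrank_invariantForms]
      simp)
  exact ⟨κ, fun w => (hκ w).1,
    linearIndependent_glue hw (single_dual _) (fun w _ => (hκ w).2) hli⟩

end OpenGraph.IsLevelled

end LevelForms

end MBQC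

namespace MBQC

/-! ### Gates -/

section Gates

variable {W : Type*} [Fintype W] [DecidableEq W]

/-- The action of a matrix over `ZMod 2` on basis labels. -/
def linAct {W' : Type*} (G : Matrix W' W (ZMod 2)) (a : Bits W) : Bits W' :=
  show W' → ZMod 2 from Matrix.mulVec G a

/-- The gate that maps the basis vector `a` to the basis vector `σ a`. -/
def basisMap (σ : Bits W → Bits W) : Matrix (Bits W) (Bits W) ℂ :=
  Matrix.of fun b a => if b = σ a then 1 else 0

theorem basisMap_mul (σ τ : Bits W → Bits W) :
    basisMap σ * basisMap τ = basisMap (σ ∘ τ) := by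
  ext b a
  simp [Matrix.mul_apply, basisMap]

omit [DecidableEq W] in
theorem basisMap_id : basisMap (id : Bits W → Bits W) = 1 := by
  ext b a
  simp [basisMap, Matrix.one_apply]

theorem basisMap_mem_unitaryGroup {σ : Bits W → Bits W} (hσ : Function.Involutive σ) :
    basisMap σ ∈ Matrix.unitaryGroup (Bits W) ℂ := by
  have hstar : star (basisMap σ) = basisMap σ := by
    ext b a
    have : a = σ b ↔ b = σ a := by rw [eq_comm, hσ.eq_iff]
    simp [Matrix.star_apply, basisMap, apply_ite, this]
  rw [Matrix.mem_unitaryGroup_iff, hstar, basisMap_mul, hσ.comp_self, basisMap_id]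

theorem diagonal_mem_unitaryGroup {ι : Type*} [Fintype ι] [DecidableEq ι] {D : ι → ℂ}
    (hD : ∀ b, D b * star (D b) = 1) : Matrix.diagonal D ∈ Matrix.unitaryGroup ι ℂ := by
  rw [Matrix.mem_unitaryGroup_iff, Matrix.star_eq_conjTranspose, Matrix.diagonal_conjTranspose,
    Matrix.diagonal_mul_diagonal, ← Matrix.diagonal_one]
  congr 1
  funext b
  exact hD b

theorem CliffordGate.matrix_cnot (c t : W) (h : c ≠ t) :
    (CliffordGate.cnot c t h).matrix = basisMap fun a => Function.update a t (a t + a c) := rfl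

theorem CliffordGate.matrix_mem_unitaryGroup (γ : CliffordGate W) :
    γ.matrix ∈ Matrix.unitaryGroup (Bits W) ℂ := by
  cases γ with
  | cz u v h =>
    refine diagonal_mem_unitaryGroup fun b => ?_
    split_ifs <;> simp
  | cnot c t h =>
    rw [CliffordGate.matrix_cnot]
    refine basisMap_mem_unitaryGroup fun a => ?_
    ext w
    by_cases hw : w = t
    · subst hw
      simp only [Function.update_self, Function.update_of_ne h]
      generalize a w = p
      generalize a c = q
      revert p q
      decide
    · simp [Function.update_of_ne hw]

theorem transvection_mulVec {R : Type*} [CommRing R] (i j : W) (a : W → R) :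
    Matrix.mulVec (Matrix.transvection i j 1) a = Function.update a i (a i + a j) := by
  rw [Matrix.transvection, Matrix.add_mulVec, Matrix.one_mulVec, Matrix.single_mulVec]
  ext w
  by_cases hw : w = i
  · subst hw
    simp
  · simp [hw]

theorem cnot_eq_basisMap_transvection (c t : W) (h : c ≠ t) :
    (CliffordGate.cnot c t h).matrix = basisMap (linAct (Matrix.transvection t c 1)) := by
  rw [CliffordGate.matrix_cnot]
  congr 1
  funext a
  exact (transvection_mulVec (R := ZMod 2) t c a).symm

omit [DecidableEq W] in
theorem linAct_mul {V : Type*} [Fintype V] (G : Matrix W W (ZMod 2)) (H : Matrix W V (ZMod 2)) :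
    linAct (G * H) = linAct G ∘ linAct H := by
  funext a
  exact (Matrix.mulVec_mulVec (α := ZMod 2) a G H).symm

theorem linAct_one : linAct (1 : Matrix W W (ZMod 2)) = (id : Bits W → Bits W) := by
  funext a
  exact Matrix.one_mulVec (α := ZMod 2) a

/-- Every invertible linear map on basis labels is implemented by `CNOT` gates. -/
theorem exists_cnot_circuit (G : Matrix W W (ZMod 2)) (hG : G.det ≠ 0) :
    ∃ l : List (CliffordGate W), (l.map CliffordGate.matrix).prod = basisMap (linAct G) := by
  refine Matrix.diagonal_transvection_induction_of_det_ne_zero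
    (fun G => ∃ l : List (CliffordGate W), (l.map CliffordGate.matrix).prod = basisMap (linAct G))
    G hG ?_ ?_ ?_
  · intro D hD
    -- Over the two-element field an invertible diagonal matrix is the identity, and a transvection
    -- is trivial or a single CNOT.
    have : D = 1 := by
      funext w
      rw [Matrix.det_diagonal, Finset.prod_ne_zero_iff] at hD
      have := hD w (Finset.mem_univ _)
      change D w = 1
      generalize D w = p at this
      clear * - this
      revert p
      decide
    refine ⟨[], ?_⟩
    rw [this, show Matrix.diagonal (1 : W → ZMod 2) = 1 from Matrix.diagonal_one, linAct_one,
      basisMap_id]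
    rfl
  · rintro ⟨i, j, hij, c⟩
    have hc : c = 0 ∨ c = 1 := by revert c; decide
    rcases hc with rfl | rfl
    · refine ⟨[], ?_⟩
      simp [Matrix.TransvectionStruct.toMatrix, linAct_one, basisMap_id]
    · refine ⟨[CliffordGate.cnot j i hij.symm], ?_⟩
      simp [Matrix.TransvectionStruct.toMatrix, cnot_eq_basisMap_transvection]
  · rintro A B - - ⟨l, hl⟩ ⟨l', hl'⟩
    exact ⟨l ++ l', by rw [List.map_append, List.prod_append, hl, hl', basisMap_mul, linAct_mul]⟩

open Classical in
/-- The sign that the `CZ` gate on the pair `e` gives to a basis vector. -/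
noncomputable def pairSign {V : Type*} (e : Sym2 V) (x : Bits V) : ℂ :=
  if ∀ v ∈ e, x v = 1 then -1 else 1

theorem exists_cz_circuit {V : Type*} (wire : V → W) (s : Finset (Sym2 V))
    (hs : ∀ u v, s(u, v) ∈ s → wire u ≠ wire v) :
    ∃ l : List (CliffordGate W), (l.map CliffordGate.matrix).prod =
      Matrix.diagonal fun b => ∏ e ∈ s, pairSign e (b ∘ wire) := by
  classical
  induction s using Finset.induction_on with
  | empty => exact ⟨[], by simp⟩
  | insert e s he ih =>
    obtain ⟨l, hl⟩ := ih fun u v huv => hs u v (Finset.mem_insert_of_mem huv)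
    induction e using Sym2.ind with
    | _ u v =>
      refine ⟨CliffordGate.cz (wire u) (wire v) (hs u v (Finset.mem_insert_self _ _)) :: l, ?_⟩
      rw [List.map_cons, List.prod_cons, hl, CliffordGate.matrix, Matrix.diagonal_mul_diagonal]
      congr 1
      funext b
      rw [Finset.prod_insert he]
      simp [pairSign]

theorem jGate_mul_star (θ : ℝ) : jGate θ * star (jGate θ) = 1 := by
  have h2 : ((√2 : ℝ) : ℂ) * (√2 : ℝ) = 2 := by
    rw [← Complex.ofReal_mul, Real.mul_self_sqrt (by norm_num)]; norm_num
  have h0 : ((√2 : ℝ) : ℂ) ≠ 0 := by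
    intro h; rw [h] at h2; norm_num at h2
  have he : Complex.exp (-(θ * Complex.I)) * Complex.exp (θ * Complex.I) = 1 := by
    rw [← Complex.exp_add]; simp
  have hc : (starRingEnd ℂ) (Complex.exp (-(θ * Complex.I))) = Complex.exp (θ * Complex.I) := by
    rw [← Complex.exp_conj]; simp
  ext i j
  fin_cases i <;> fin_cases j <;>
    simp [jGate, Matrix.mul_apply, Fin.sum_univ_two, Matrix.star_apply, hc] <;>
    field_simp <;>
    first | linear_combination he - h2 | linear_combination -he

theorem jLayerMatrix_mem_unitaryGroup (L : W → Option ℝ) :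
    jLayerMatrix L ∈ Matrix.unitaryGroup (Bits W) ℂ := by
  rw [Matrix.mem_unitaryGroup_iff]
  set M : W → Matrix (Fin 2) (Fin 2) ℂ := fun w => match L w with
    | some θ => jGate θ
    | none => 1 with hM
  have hMu : ∀ w, M w * star (M w) = 1 := by
    intro w
    simp only [hM]
    split
    · exact jGate_mul_star _
    · simp
  have hJ : ∀ b a, jLayerMatrix L b a = ∏ w, M w (b w) (a w) := fun b a => rfl
  ext b a
  have : ∀ c : Bits W, jLayerMatrix L b c * star (jLayerMatrix L) c a =
      ∏ w, M w (b w) (c w) * star (M w) (c w) (a w) := by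
    intro c
    rw [Matrix.star_apply, hJ, hJ, Finset.prod_mul_distrib]
    congr 1
    simp [Matrix.star_apply]
  rw [Matrix.mul_apply, Finset.sum_congr rfl fun c _ => this c]
  -- The sum over intermediate labels factors over the wires into products of `2 × 2` matrices.
  have h2 := Finset.prod_univ_sum (fun _ : W => (Finset.univ : Finset (Fin 2)))
    fun w i => M w (b w) i * star (M w) i (a w)
  rw [Fintype.piFinset_univ] at h2
  rw [← h2]
  simp_rw [← Matrix.mul_apply, hMu, Matrix.one_apply]
  by_cases hba : b = a
  · simp [hba]
  · rw [if_neg hba]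
    obtain ⟨w, hw⟩ := Function.ne_iff.1 hba
    exact Finset.prod_eq_zero (Finset.mem_univ w) (if_neg hw)

theorem LayeredCircuit.matrix_mem_unitaryGroup {d : ℕ} (C : LayeredCircuit W d) :
    C.matrix ∈ Matrix.unitaryGroup (Bits W) ℂ := by
  refine Submonoid.list_prod_mem _ fun A hA => ?_
  obtain ⟨k, rfl⟩ := List.mem_ofFn.1 hA
  refine Submonoid.mul_mem _ (Submonoid.list_prod_mem _ fun B hB => ?_)
    (jLayerMatrix_mem_unitaryGroup _)
  obtain ⟨γ, -, rfl⟩ := List.mem_map.1 hB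
  exact γ.matrix_mem_unitaryGroup

end Gates

end MBQC

namespace MBQC

/-! ### Sums over the labels of all vertices -/

section PathSum

variable {V W : Type*} [Fintype V]

/-- The value of a linear form on a basis label. -/
def ev (φ : V → ZMod 2) (x : Bits V) : Fin 2 := show ZMod 2 from dotProduct (α := ZMod 2) φ x

theorem linAct_of (B : W → V → ZMod 2) (x : Bits V) (w : W) :
    linAct (Matrix.of B) x w = ev (B w) x := rfl

/-- Translation of basis labels. -/
def shift (a : V → ZMod 2) (x : Bits V) : Bits V := fun v => Add.add (α := ZMod 2) (x v) (a v)

theorem ev_shift_of_eq_zero {φ a : V → ZMod 2} (h : a ⬝ᵥ φ = 0) (x : Bits V) :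
    ev φ (shift a x) = ev φ x := by
  have := dotProduct_add (α := ZMod 2) φ x a
  rw [dotProduct_comm φ a, h, add_zero] at this
  exact this

theorem ev_shift_of_eq_one {φ a : V → ZMod 2} (h : a ⬝ᵥ φ = 1) (x : Bits V) (t : Fin 2) :
    ev φ (shift a x) = t ↔ ¬ ev φ x = t := by
  have h1 := dotProduct_add (α := ZMod 2) φ x a
  rw [dotProduct_comm φ a, h] at h1
  have h2 : ∀ p t : ZMod 2, p + 1 = t ↔ ¬ p = t := by decide
  have h3 := h2 (dotProduct (α := ZMod 2) φ x) t
  rw [← h1] at h3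
  exact h3

omit [Fintype V] in
theorem shift_involutive (a : V → ZMod 2) : Function.Involutive (shift a) := by
  have h : ∀ p q : ZMod 2, Add.add (Add.add p q) q = p := by decide
  exact fun x => funext fun v => h (x v) (a v)

omit [Fintype V] in
theorem shift_apply_of_eq_zero {a : V → ZMod 2} {v : V} (h : a v = 0) (x : Bits V) :
    shift a x v = x v :=
  (congrArg (Add.add (α := ZMod 2) (x v)) h).trans (add_zero (M := ZMod 2) (x v))

theorem ev_single [DecidableEq V] (v : V) (x : Bits V) : ev (Pi.single v 1) x = x v :=
  (single_dotProduct (α := ZMod 2) x 1 v).trans (one_mul (M := ZMod 2) (x v))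

variable [DecidableEq V]

/-- Translation by `a` exchanges the two fibres of `z` and preserves `H`, so each fibre carries half
of the sum. -/
theorem sum_eq_two_mul_sum_ev {H : Bits V → ℂ} {z a : V → ZMod 2} (ha : a ⬝ᵥ z = 1)
    (hH : ∀ x, H (shift a x) = H x) (t : Fin 2) :
    ∑ x, H x = 2 * ∑ x, if ev z x = t then H x else 0 := by
  have h1 : ∑ x, (if ev z x = t then H x else 0) = ∑ x, if ev z x = t then 0 else H x := by
    rw [← Equiv.sum_comp (shift_involutive a).toPerm]
    refine Finset.sum_congr rfl fun x _ => ?_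
    simp only [Function.Involutive.coe_toPerm, hH, ev_shift_of_eq_one ha, ite_not]
  rw [two_mul]
  nth_rewrite 2 [h1]
  rw [← Finset.sum_add_distrib]
  refine Finset.sum_congr rfl fun x _ => ?_
  split_ifs <;> simp

/-- A function that is invariant under translations has the same sum over all fibres of a family
of linear forms that is dual to the translations. -/
theorem sum_eq_two_pow_mul_sum_ev {ι : Type*} [DecidableEq ι] (s : Finset ι) {z a : ι → V → ZMod 2}
    (hdual : ∀ u ∈ s, ∀ v ∈ s, a u ⬝ᵥ z v = if u = v then 1 else 0) (t : ι → Fin 2) :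
    ∀ {H : Bits V → ℂ}, (∀ u ∈ s, ∀ x, H (shift (a u) x) = H x) →
    ∑ x, H x = 2 ^ s.card * ∑ x, if ∀ v ∈ s, ev (z v) x = t v then H x else 0 := by
  induction s using Finset.induction_on with
  | empty => intro H _; simp
  | insert u s hu ih =>
    intro H hH
    rw [sum_eq_two_mul_sum_ev (z := z u) (by
        simpa using hdual u (Finset.mem_insert_self _ _) u (Finset.mem_insert_self _ _))
        (hH u (Finset.mem_insert_self _ _)) (t u),
      ih (fun v hv w hw => hdual v (Finset.mem_insert_of_mem hv) w (Finset.mem_insert_of_mem hw)),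
      Finset.card_insert_of_notMem hu, pow_succ', mul_assoc]
    · congr 2
      refine Finset.sum_congr rfl fun x _ => ?_
      simp only [Finset.forall_mem_insert]
      by_cases h1 : ev (z u) x = t u <;> simp [h1]
    -- Restricting to a fibre of `z u` keeps the invariance under the other translations, which do
    -- not change `z u`.
    · intro v hv x
      have hvu : v ≠ u := fun e => hu (e ▸ hv)
      rw [hH v (Finset.mem_insert_of_mem hv), ev_shift_of_eq_zero]
      rw [hdual v (Finset.mem_insert_of_mem hv) u (Finset.mem_insert_self _ _), if_neg hvu]

/-- The amplitudes `∑ h x` over all `x` that extend the input label and on which the linear forms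
`B` take the values of the output label. -/
noncomputable def pathSum [DecidableEq W] [Fintype W] (I : Finset V) (B : W → V → ZMod 2)
    (h : Bits V → ℂ) : Matrix (Bits W) (Bits I) ℂ :=
  Matrix.of fun y a => ∑ x, if linAct (Matrix.of B) x = y ∧ ∀ i : I, x i = a i then h x else 0

variable [Fintype W] [DecidableEq W] {I : Finset V}

theorem mul_pathSum_apply (M : Matrix (Bits W) (Bits W) ℂ) (B : W → V → ZMod 2)
    (h : Bits V → ℂ) (y : Bits W) (a : Bits I) :
    (M * pathSum I B h) y a = ∑ x, if ∀ i : I, x i = a i then M y (linAct (Matrix.of B) x) * h x else 0 := by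
  simp only [Matrix.mul_apply, pathSum, Matrix.of_apply, Finset.mul_sum]
  rw [Finset.sum_comm]
  refine Finset.sum_congr rfl fun x _ => ?_
  rw [Finset.sum_eq_single_of_mem (linAct (Matrix.of B) x) (Finset.mem_univ _)]
  · simp
  · intro y' _ hy'
    rw [if_neg (fun hh => hy' hh.1.symm), mul_zero]

theorem basisMap_mul_pathSum (G : Matrix W W (ZMod 2)) (B : W → V → ZMod 2)
    (h : Bits V → ℂ) : basisMap (linAct G) * pathSum I B h =
      pathSum I (fun w => ∑ w', G w w' • B w') h := by
  ext y a
  rw [mul_pathSum_apply, pathSum, Matrix.of_apply]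
  refine Finset.sum_congr rfl fun x _ => ?_
  have hG : linAct (Matrix.of fun w => ∑ w', G w w' • B w') x =
      linAct G (linAct (Matrix.of B) x) := by
    have : (Matrix.of fun w => ∑ w', G w w' • B w') = G * Matrix.of B := by
      ext w v
      simp [Matrix.mul_apply]
    rw [this, linAct_mul]
    rfl
  rw [hG]
  simp only [basisMap, Matrix.of_apply, eq_comm (a := y)]
  by_cases h1 : linAct G (linAct (Matrix.of B) x) = y <;> simp [h1]

theorem diagonal_mul_pathSum (D : Bits W → ℂ) (B : W → V → ZMod 2)
    (h : Bits V → ℂ) : Matrix.diagonal D * pathSum I B h =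
      pathSum I B fun x => D (linAct (Matrix.of B) x) * h x := by
  ext y a
  rw [mul_pathSum_apply, pathSum, Matrix.of_apply]
  refine Finset.sum_congr rfl fun x _ => ?_
  rw [Matrix.diagonal_apply]
  by_cases h1 : linAct (Matrix.of B) x = y
  · simp [h1]
  · simp [h1, Ne.symm h1]

/-- The phase `e^{-iθy}`. -/
noncomputable def measPhase (θ : ℝ) (y : Fin 2) : ℂ :=
  if y = 1 then Complex.exp (-(θ * Complex.I)) else 1

/-- The sign `(-1)^{pq}`. -/
noncomputable def czSign (p q : Fin 2) : ℂ := if p = 1 ∧ q = 1 then -1 else 1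

theorem jGate_apply (θ : ℝ) (y' y : Fin 2) :
    jGate θ y' y = (1 / (√2 : ℝ) : ℂ) * (measPhase θ y * czSign y y') := by
  fin_cases y <;> fin_cases y' <;> simp [jGate, measPhase, czSign]

theorem jLayerMatrix_apply {L : Finset V} {wire : V → W} (hw : Set.InjOn wire L) {α : V → ℝ}
    {jl : W → Option ℝ} (hj : ∀ v ∈ L, jl (wire v) = some (α v))
    (hj' : ∀ w, (∀ v ∈ L, wire v ≠ w) → jl w = none) (y' y : Bits W) :
    jLayerMatrix jl y' y = (1 / (√2 : ℝ) : ℂ) ^ L.card *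
      if ∀ w, (∀ v ∈ L, wire v ≠ w) → y w = y' w then
        ∏ v ∈ L, measPhase (α v) (y (wire v)) * czSign (y (wire v)) (y' (wire v)) else 0 := by
  set M : W → Matrix (Fin 2) (Fin 2) ℂ := fun w => match jl w with
    | some θ => jGate θ
    | none => 1 with hM
  have hJ : jLayerMatrix jl y' y = ∏ w, M w (y' w) (y w) := rfl
  rw [hJ, ← Finset.prod_mul_prod_compl (L.image wire), Finset.prod_image hw]
  have h1 : ∀ v ∈ L, M (wire v) (y' (wire v)) (y (wire v)) =
      (1 / (√2 : ℝ) : ℂ) * (measPhase (α v) (y (wire v)) * czSign (y (wire v)) (y' (wire v))) := by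
    intro v hv
    simp only [hM, hj v hv]
    exact jGate_apply _ _ _
  have h2 : ∀ w ∈ (L.image wire)ᶜ, M w (y' w) (y w) = if y w = y' w then 1 else 0 := by
    intro w hw'
    have : ∀ v ∈ L, wire v ≠ w := by simpa using hw'
    simp only [hM, hj' w this]
    simp [Matrix.one_apply, eq_comm]
  rw [Finset.prod_congr rfl h1, Finset.prod_congr rfl h2, Finset.prod_mul_distrib,
    Finset.prod_const, Finset.prod_ite_zero, mul_assoc]
  simp

/-- After the J gates the new labels are constrained by no form. The translations `a u` preserve the
summand and flip the forms `z u`, so restricting to `z v` equal to the new label costs a factor `2`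
per vertex. With the `1 / √2` of the gate this leaves `√2`. -/
theorem jLayerMatrix_mul_pathSum {L : Finset V} {wire : V → W} (hw : Set.InjOn wire L)
    {α : V → ℝ} {jl : W → Option ℝ} (hj : ∀ v ∈ L, jl (wire v) = some (α v))
    (hj' : ∀ w, (∀ v ∈ L, wire v ≠ w) → jl w = none) {κ : W → V → ZMod 2}
    {a z : V → V → ZMod 2} (hdual : ∀ u ∈ L, ∀ v ∈ L, a u ⬝ᵥ z v = if u = v then 1 else 0)
    (hκ : ∀ w, ∀ u ∈ L, a u ⬝ᵥ κ w = 0)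
    (haL : ∀ u ∈ L, ∀ v ∈ L, a u v = 0) (haI : ∀ u ∈ L, ∀ i ∈ I, a u i = 0)
    {h : Bits V → ℂ} (hh : ∀ u ∈ L, ∀ x, h (shift (a u) x) = h x) :
    jLayerMatrix jl * pathSum I (glue L wire (fun v => Pi.single v 1) κ) h =
      ((√2 : ℝ) : ℂ) ^ L.card • pathSum I (glue L wire z κ) fun x =>
        (∏ v ∈ L, measPhase (α v) (x v) * czSign (x v) (ev (z v) x)) * h x := by
  ext y b
  rw [mul_pathSum_apply, Matrix.smul_apply, pathSum, Matrix.of_apply]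
  have hβ : ∀ x : Bits V, ∀ v ∈ L,
      linAct (Matrix.of (glue L wire (fun v => Pi.single v 1) κ)) x (wire v) = x v := by
    intro x v hv
    rw [linAct_of, glue_wire hw _ _ hv, ev_single]
  have hγ : ∀ x : Bits V, linAct (Matrix.of (glue L wire z κ)) x = y ↔
      (∀ v ∈ L, ev (z v) x = y (wire v)) ∧ ∀ w, (∀ v ∈ L, wire v ≠ w) → ev (κ w) x = y w := by
    intro x
    constructor
    · rintro rfl
      refine ⟨fun v hv => ?_, fun w hw' => ?_⟩
      · rw [linAct_of, glue_wire hw _ _ hv]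
      · rw [linAct_of, glue_of_ne _ _ hw']
    · rintro ⟨h1, h2⟩
      funext w
      rw [linAct_of]
      by_cases hw' : ∃ v ∈ L, wire v = w
      · obtain ⟨v, hv, rfl⟩ := hw'
        rw [glue_wire hw _ _ hv, h1 v hv]
      · push Not at hw'
        rw [glue_of_ne _ _ hw', h2 w hw']
  have hlhs : ∀ x : Bits V, (if ∀ i : I, x i = b i then
      jLayerMatrix jl y (linAct (Matrix.of (glue L wire (fun v => Pi.single v 1) κ)) x) * h x else 0) =
      (1 / (√2 : ℝ) : ℂ) ^ L.card *
        if (∀ i : I, x i = b i) ∧ (∀ w, (∀ v ∈ L, wire v ≠ w) → ev (κ w) x = y w) then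
          (∏ v ∈ L, measPhase (α v) (x v) * czSign (x v) (y (wire v))) * h x else 0 := by
    intro x
    rw [jLayerMatrix_apply hw hj hj']
    have e1 : (∀ w, (∀ v ∈ L, wire v ≠ w) →
        linAct (Matrix.of (glue L wire (fun v => Pi.single v 1) κ)) x w = y w) ↔
        ∀ w, (∀ v ∈ L, wire v ≠ w) → ev (κ w) x = y w := by
      refine forall_congr' fun w => forall_congr' fun hw' => ?_
      rw [linAct_of, glue_of_ne _ _ hw']
    have e2 : ∏ v ∈ L, measPhase (α v)
          (linAct (Matrix.of (glue L wire (fun v => Pi.single v 1) κ)) x (wire v)) *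
          czSign (linAct (Matrix.of (glue L wire (fun v => Pi.single v 1) κ)) x (wire v)) (y (wire v)) =
        ∏ v ∈ L, measPhase (α v) (x v) * czSign (x v) (y (wire v)) :=
      Finset.prod_congr rfl fun v hv => by rw [hβ x v hv]
    rw [e2]
    simp only [e1]
    by_cases c1 : ∀ i : I, x i = b i
    · rw [if_pos c1]
      by_cases c2 : ∀ w, (∀ v ∈ L, wire v ≠ w) → ev (κ w) x = y w
      · rw [if_pos c2, if_pos ⟨c1, c2⟩, mul_assoc]
      · rw [if_neg c2, if_neg fun hh => c2 hh.2, mul_zero, zero_mul]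
    · rw [if_neg c1, if_neg fun hh => c1 hh.1, mul_zero]
  rw [Finset.sum_congr rfl fun x _ => hlhs x, ← Finset.mul_sum,
    sum_eq_two_pow_mul_sum_ev L hdual (fun v => y (wire v)), ← mul_assoc]
  · have hc : (1 / (√2 : ℝ) : ℂ) ^ L.card * 2 ^ L.card = ((√2 : ℝ) : ℂ) ^ L.card := by
      rw [← mul_pow]
      congr 1
      have h2 : ((√2 : ℝ) : ℂ) * (√2 : ℝ) = 2 := by
        rw [← Complex.ofReal_mul, Real.mul_self_sqrt (by norm_num)]; norm_num
      have h0 : ((√2 : ℝ) : ℂ) ≠ 0 := by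
        intro h; rw [h] at h2; norm_num at h2
      rw [← h2]
      field_simp
    rw [hc, smul_eq_mul]
    congr 1
    refine Finset.sum_congr rfl fun x _ => ?_
    simp only [hγ]
    by_cases c3 : ∀ v ∈ L, ev (z v) x = y (wire v)
    · have e3 : ∏ v ∈ L, measPhase (α v) (x v) * czSign (x v) (y (wire v)) =
          ∏ v ∈ L, measPhase (α v) (x v) * czSign (x v) (ev (z v) x) :=
        Finset.prod_congr rfl fun v hv => by rw [c3 v hv]
      rw [if_pos c3, e3]
      refine if_congr ?_ rfl rfl
      tauto
    · rw [if_neg c3, if_neg]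
      tauto
  -- The translation fixes the input labels, the coordinates in `L`, the forms `κ w` and the
  -- function `h`.
  · intro u hu x
    have e1 : ∀ i : I, shift (a u) x i = x i := fun i => shift_apply_of_eq_zero (haI u hu i i.2) x
    have e2 : ∀ w, ev (κ w) (shift (a u) x) = ev (κ w) x := fun w => by
      rw [ev_shift_of_eq_zero (hκ w u hu)]
    have e3 : ∏ v ∈ L, measPhase (α v) (shift (a u) x v) * czSign (shift (a u) x v) (y (wire v)) =
        ∏ v ∈ L, measPhase (α v) (x v) * czSign (x v) (y (wire v)) :=
      Finset.prod_congr rfl fun v hv => by rw [shift_apply_of_eq_zero (haL u hu v hv)]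
    simp only [e1, e2, e3, hh u hu x]

end PathSum

end MBQC

namespace MBQC

/-! ### Phases of the path sums -/

section Phases

variable {V : Type*}

theorem czSign_zero_right (p : Fin 2) : czSign p 0 = 1 := by simp [czSign]

theorem czSign_add (p : Fin 2) (q r : ZMod 2) :
    czSign p (show ZMod 2 from q + r) = czSign p q * czSign p r := by
  have h : ∀ q r : ZMod 2, q + r = 1 ↔ ((q = 1 ∧ ¬ r = 1) ∨ (¬ q = 1 ∧ r = 1)) := by decide
  have h' : ((show Fin 2 from (show ZMod 2 from q + r)) = (1 : Fin 2)) ↔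
      (((show Fin 2 from q) = 1 ∧ ¬ (show Fin 2 from r) = 1) ∨
        (¬ (show Fin 2 from q) = 1 ∧ (show Fin 2 from r) = 1)) := h q r
  unfold czSign
  by_cases hp : p = 1
  · by_cases hq : (show Fin 2 from q) = 1 <;> by_cases hr : (show Fin 2 from r) = 1 <;>
      simp_all
  · simp [hp]

theorem czSign_sum {ι : Type*} (p : Fin 2) (s : Finset ι) (f : ι → ZMod 2) :
    czSign p (show ZMod 2 from ∑ i ∈ s, f i) = ∏ i ∈ s, czSign p (f i) := by
  classical
  induction s using Finset.induction_on with
  | empty => exact czSign_zero_right p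
  | insert i s hi ih =>
    rw [Finset.prod_insert hi, ← ih, ← czSign_add, Finset.sum_insert hi]

theorem pairSign_mk (u v : V) (x : Bits V) : pairSign s(u, v) x = czSign (x u) (x v) := by
  simp [pairSign, czSign]

variable [Fintype V] [DecidableEq V] {Γ : OpenGraph V} {g : V → Finset V} {lev : V → ℕ}

open Classical in
/-- The edges between vertices on level `k`. -/
noncomputable def levelEdges (Γ : OpenGraph V) (lev : V → ℕ) (k : ℕ) : Finset (Sym2 V) :=
  Γ.graph.edgeFinset.filter fun e => ∀ v ∈ e, lev v = k

theorem mk_mem_levelEdges {k : ℕ} {u v : V} : s(u, v) ∈ levelEdges Γ lev k ↔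
    Γ.graph.Adj u v ∧ lev u = k ∧ lev v = k := by
  simp [levelEdges]

-- The sign is multiplicative in its second argument, so one coupling to the lower neighbourhood
-- form accounts for all downward edges at `v`.
omit [DecidableEq V] in
open Classical in
theorem czSign_lowerNbhd (v : V) (x : Bits V) : czSign (x v) (ev (Γ.lowerNbhd lev v) x) =
    ∏ w ∈ Finset.univ.filter fun w => Γ.graph.Adj v w ∧ lev w < lev v, czSign (x v) (x w) := by
  have : ev (Γ.lowerNbhd lev v) x = (show ZMod 2 from
      ∑ w ∈ Finset.univ.filter fun w => Γ.graph.Adj v w ∧ lev w < lev v,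
        (show ZMod 2 from x w)) := by
    rw [Finset.sum_filter]
    refine Finset.sum_congr rfl fun w _ => ?_
    by_cases hw : Γ.graph.Adj v w ∧ lev w < lev v
    · rw [OpenGraph.lowerNbhd, if_pos hw, if_pos hw]
      exact one_mul (M := ZMod 2) _
    · rw [OpenGraph.lowerNbhd, if_neg hw, if_neg hw]
      exact zero_mul (M₀ := ZMod 2) _
  rw [this, czSign_sum]

open Classical in
/-- The total sign of the `CZ` gates on all edges, sorted by levels. -/
theorem prod_pairSign_edgeFinset {d : ℕ} (hd : ∀ v, lev v ≤ d) (x : Bits V) :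
    ∏ e ∈ Γ.graph.edgeFinset, pairSign e x =
      (∏ v, czSign (x v) (ev (Γ.lowerNbhd lev v) x)) *
        ∏ k ∈ Finset.Ico 0 (d + 1), ∏ e ∈ levelEdges Γ lev k, pairSign e x := by
  -- An edge either stays inside one level or has a unique upper end, where it is counted in the
  -- lower neighbourhood.
  rw [← Finset.prod_filter_mul_prod_filter_not Γ.graph.edgeFinset
    (fun e => ∃ k, ∀ v ∈ e, lev v = k), mul_comm]
  congr 1
  · simp_rw [czSign_lowerNbhd]
    rw [Finset.prod_sigma']
    symm
    refine Finset.prod_nbij (fun p => s(p.1, p.2)) ?_ ?_ ?_ ?_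
    · rintro ⟨v, w⟩ h
      simp only [Finset.mem_sigma, Finset.mem_filter, Finset.mem_univ, true_and] at h
      simp only [Finset.mem_filter, SimpleGraph.mem_edgeFinset, SimpleGraph.mem_edgeSet, h.1,
        Sym2.mem_iff, forall_eq_or_imp, forall_eq, true_and, not_exists]
      rintro k ⟨h1, h2⟩
      exact h.2.ne (h2.trans h1.symm)
    · rintro ⟨v, w⟩ h ⟨v', w'⟩ h' e
      simp only [Finset.coe_sigma, Set.mem_sigma_iff, Finset.coe_filter, Finset.mem_univ,
        true_and, Set.mem_ofPred_eq] at h h'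
      rcases Sym2.eq_iff.1 e with ⟨rfl, rfl⟩ | ⟨rfl, rfl⟩
      · rfl
      · exact absurd h.2.2 (lt_asymm h'.2.2)
    · intro e h
      induction e using Sym2.ind with
      | _ u v =>
        simp only [Finset.coe_filter, Set.mem_ofPred_eq, SimpleGraph.mem_edgeFinset,
          SimpleGraph.mem_edgeSet, Sym2.mem_iff, forall_eq_or_imp, forall_eq, not_exists] at h
        rcases lt_trichotomy (lev u) (lev v) with hl | hl | hl
        · exact ⟨⟨v, u⟩, by simp [h.1.symm, hl], Sym2.eq_swap⟩
        · exact absurd ⟨rfl, hl.symm⟩ (h.2 (lev u))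
        · exact ⟨⟨u, v⟩, by simp [h.1, hl], rfl⟩
    · rintro ⟨v, w⟩ _
      exact (pairSign_mk v w x).symm
  · rw [← Finset.prod_biUnion]
    · refine Finset.prod_congr ?_ fun _ _ => rfl
      ext e
      induction e using Sym2.ind with
      | _ u v =>
        simp only [Finset.mem_filter, SimpleGraph.mem_edgeFinset, SimpleGraph.mem_edgeSet,
          Sym2.mem_iff, forall_eq_or_imp, forall_eq, Finset.mem_biUnion, mk_mem_levelEdges,
          Finset.mem_Ico]
        constructor
        · rintro ⟨h, k, h1, h2⟩
          exact ⟨k, ⟨Nat.zero_le _, by have := hd u; omega⟩, h, h1, h2⟩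
        · rintro ⟨k, -, h, h1, h2⟩
          exact ⟨h, k, h1, h2⟩
    · intro j _ k _ hjk
      refine Finset.disjoint_left.2 fun e he he' => hjk ?_
      induction e using Sym2.ind with
      | _ u v => rw [mk_mem_levelEdges] at he he'; omega

/-- The phases that are acquired by the vertices on levels above `k`. -/
noncomputable def vertexPhase (Γ : OpenGraph V) (lev : V → ℕ) (α : V → ℝ) (k : ℕ)
    (x : Bits V) : ℂ :=
  ∏ v ∈ Finset.univ.filter fun v => k < lev v,
    measPhase (α v) (x v) * czSign (x v) (ev (Γ.lowerNbhd lev v) x)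

/-- The signs of the edges inside the levels `k, …, d`. -/
noncomputable def edgePhase (Γ : OpenGraph V) (lev : V → ℕ) (d k : ℕ) (x : Bits V) : ℂ :=
  ∏ j ∈ Finset.Ico k (d + 1), ∏ e ∈ levelEdges Γ lev j, pairSign e x

theorem vertexPhase_eq_mul (α : V → ℝ) (k : ℕ) (x : Bits V) :
    vertexPhase Γ lev α k x =
      (∏ v ∈ levelSet lev (k + 1),
        measPhase (α v) (x v) * czSign (x v) (ev (Γ.lowerNbhd lev v) x)) *
        vertexPhase Γ lev α (k + 1) x := by
  rw [vertexPhase, vertexPhase, ← Finset.prod_union]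
  · refine Finset.prod_congr ?_ fun _ _ => rfl
    ext v
    simp only [Finset.mem_filter, Finset.mem_univ, true_and, Finset.mem_union, mem_levelSet]
    omega
  · refine Finset.disjoint_left.2 fun v h h' => ?_
    simp only [Finset.mem_filter, Finset.mem_univ, true_and, mem_levelSet] at h h'
    omega

theorem edgePhase_eq_mul {d k : ℕ} (hk : k ≤ d) (x : Bits V) :
    edgePhase Γ lev d k x =
      (∏ e ∈ levelEdges Γ lev k, pairSign e x) * edgePhase Γ lev d (k + 1) x :=
  Finset.prod_eq_prod_Ico_succ_bot (Nat.lt_succ_of_le hk) _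

/-- Vertices above level `k` lie outside `g u`, and their lower neighbourhoods pair to `0` with it.
-/
theorem OpenGraph.IsLevelled.vertexPhase_shift (h : Γ.IsLevelled g lev) (α : V → ℝ) {k : ℕ} {u : V}
    (hu : u ∉ Γ.outputs) (huk : lev u ≤ k) (x : Bits V) :
    vertexPhase Γ lev α k (shift (indVec (g u)) x) = vertexPhase Γ lev α k x := by
  refine Finset.prod_congr rfl fun v hv => ?_
  have hv' : k < lev v := by simpa using hv
  have h1 : v ∉ g u := fun hvu => by have := h.lt_of_mem u hu v hvu; omega
  rw [shift_apply_of_eq_zero (by simp [indVec, h1]), ev_shift_of_eq_zero]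
  rw [dotProduct_comm, h.lowerNbhd_dotProduct hu (by omega), if_neg]
  rintro rfl
  omega

theorem OpenGraph.IsLevelled.edgePhase_shift (h : Γ.IsLevelled g lev) {d k : ℕ} {u : V}
    (hu : u ∉ Γ.outputs) (huk : lev u ≤ k) (x : Bits V) :
    edgePhase Γ lev d k (shift (indVec (g u)) x) = edgePhase Γ lev d k x := by
  refine Finset.prod_congr rfl fun j hj => Finset.prod_congr rfl fun e he => ?_
  have hj' := (Finset.mem_Ico.1 hj).1
  have key : ∀ v, lev v = j → shift (indVec (g u)) x v = x v := by
    intro v hv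
    have h1 : v ∉ g u := fun hvu => by have := h.lt_of_mem u hu v hvu; omega
    exact shift_apply_of_eq_zero (by simp [indVec, h1]) x
  induction e using Sym2.ind with
  | _ v w =>
    rw [mk_mem_levelEdges] at he
    rw [pairSign_mk, pairSign_mk, key v he.2.1, key w he.2.2]

end Phases

/-! ### Input and output of the path sums -/

section Ends

variable {V W : Type*} [Fintype V] [DecidableEq V] {Γ : OpenGraph V}

theorem exists_dual_family {F : Type*} [Field F] [Fintype W] [DecidableEq W] {γ : W → V → F}
    (hγ : LinearIndependent F γ) :
    ∃ a : W → V → F, ∀ u v, a u ⬝ᵥ γ v = if u = v then 1 else 0 := by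
  have hinj : LinearMap.ker (Fintype.linearCombination F γ) = ⊥ :=
    LinearMap.ker_eq_bot.2 hγ.fintypeLinearCombination_injective
  obtain ⟨f, hf⟩ := LinearMap.exists_leftInverse_of_injective _ hinj
  refine ⟨fun u v => f (Pi.single v 1) u, fun u v => ?_⟩
  have h1 := congrArg (fun φ => φ (Pi.single v 1) u) hf
  simp only [LinearMap.comp_apply, Fintype.linearCombination_apply_single, one_smul,
    LinearMap.id_apply, Pi.single_apply] at h1
  rw [← h1]
  conv_rhs => rw [← Finset.univ_sum_single (γ v)]
  rw [map_sum, Finset.sum_apply]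
  refine Finset.sum_congr rfl fun w _ => ?_
  have : (Pi.single w (γ v w) : V → F) = γ v w • Pi.single w 1 := by
    rw [← Pi.single_smul, smul_eq_mul, mul_one]
  rw [this, map_smul, Pi.smul_apply, smul_eq_mul, mul_comm]

/-- The fibres of independent forms have equal size: averaging over the translations of a dual
family, applied to the constant `1`. -/
theorem card_fiber_linAct [Fintype W] [DecidableEq W] {γ : W → V → ZMod 2}
    (hγ : LinearIndependent (ZMod 2) γ) (y : Bits W) :
    (2 : ℂ) ^ Fintype.card V = 2 ^ Fintype.card W *
      ∑ x : Bits V, if linAct (Matrix.of γ) x = y then 1 else 0 := by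
  obtain ⟨a, ha⟩ := exists_dual_family hγ
  have h := sum_eq_two_pow_mul_sum_ev Finset.univ (fun u _ v _ => ha u v) y
    (H := fun _ => (1 : ℂ)) fun _ _ _ => rfl
  simp only [Finset.sum_const, Finset.card_univ, Fintype.card_fun, Fintype.card_fin,
    nsmul_eq_mul, mul_one, Nat.cast_pow, Nat.cast_ofNat, Finset.mem_univ, true_imp_iff] at h
  rw [h]
  congr 1
  refine Finset.sum_congr rfl fun x _ => ?_
  refine if_congr ?_ rfl rfl
  rw [funext_iff]
  rfl

theorem ketPlus_zero (b : Fin 2) : ketPlus 0 b = 1 / (√2 : ℝ) := by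
  fin_cases b <;> simp [ketPlus]

theorem conj_ketPlus (θ : ℝ) (b : Fin 2) :
    (starRingEnd ℂ) (ketPlus θ b) = 1 / (√2 : ℝ) * measPhase θ b := by
  fin_cases b
  · simp [ketPlus, measPhase]
  · simp [ketPlus, measPhase, ← Complex.exp_conj, div_eq_inv_mul]

/-- The forms on the input wires already force the input labels, so the path sum counts a fibre or
vanishes. The constant divides by the fibre size and adds `1 / √2` for each wire without input,
whatever `κ` is. -/
theorem PathCover.feed_eq_pathSum (P : PathCover Γ) {κ : Γ.outputs → V → ZMod 2}
    (hli : LinearIndependent (ZMod 2) (glue Γ.inputs P.wire (fun v => Pi.single v 1) κ)) :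
    P.feed = ((1 / (√2 : ℝ) : ℂ) ^ (Γ.outputs.card - Γ.inputs.card) *
      (2 ^ Γ.outputs.card / 2 ^ Fintype.card V)) •
      pathSum Γ.inputs (glue Γ.inputs P.wire (fun v => Pi.single v 1) κ) fun _ => 1 := by
  ext y a
  rw [Matrix.smul_apply, pathSum, Matrix.of_apply, PathCover.feed, Matrix.of_apply, smul_eq_mul]
  have key : ∀ x : Bits V,
      linAct (Matrix.of (glue Γ.inputs P.wire (fun v => Pi.single v 1) κ)) x = y →
      ((∀ i : Γ.inputs, x i = a i) ↔ ∀ i : Γ.inputs, y (P.wire i) = a i) := by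
    rintro x rfl
    refine forall_congr' fun i => ?_
    rw [linAct_of, glue_wire P.wire_injOn_inputs _ _ i.2, ev_single]
  have hcard : (Finset.univ.filter fun w : Γ.outputs => ∀ i : Γ.inputs, P.wire i ≠ w).card =
      Γ.outputs.card - Γ.inputs.card := by
    have h1 : (Finset.univ.filter fun w : Γ.outputs => ∀ i : Γ.inputs, P.wire i ≠ w) =
        (Γ.inputs.image P.wire)ᶜ := by
      ext w
      simp
    rw [h1, Finset.card_compl, Finset.card_image_of_injOn P.wire_injOn_inputs, Fintype.card_coe]
  by_cases hy : ∀ i : Γ.inputs, y (P.wire i) = a i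
  · have h1 : ∀ x : Bits V, (if linAct (Matrix.of (glue Γ.inputs P.wire
        (fun v => Pi.single v 1) κ)) x = y ∧ ∀ i : Γ.inputs, x i = a i then (1 : ℂ) else 0) =
        if linAct (Matrix.of (glue Γ.inputs P.wire (fun v => Pi.single v 1) κ)) x = y
          then 1 else 0 := by
      intro x
      refine if_congr ⟨fun h => h.1, fun h => ⟨h, (key x h).2 hy⟩⟩ rfl rfl
    rw [if_pos hy, Finset.sum_congr rfl fun x _ => h1 x]
    have h2 := card_fiber_linAct hli y
    rw [Fintype.card_coe] at h2
    have h3 : (2 : ℂ) ^ Fintype.card V ≠ 0 := pow_ne_zero _ two_ne_zero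
    rw [mul_assoc, div_mul_eq_mul_div, ← h2, div_self h3, mul_one]
    simp_rw [ketPlus_zero]
    rw [Finset.prod_const]
    rw [← hcard]
  · rw [if_neg hy, Finset.sum_eq_zero, mul_zero]
    intro x _
    rw [if_neg]
    rintro ⟨h1, h2⟩
    exact hy ((key x h1).1 h2)

open Classical in
theorem OpenGraph.patternMap_eq_pathSum (Γ : OpenGraph V) (α : V → ℝ) :
    Γ.patternMap α = ((1 / (√2 : ℝ) : ℂ) ^ Γ.outputsᶜ.card * (1 / (√2 : ℝ) : ℂ) ^ Γ.inputsᶜ.card) •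
      pathSum Γ.inputs (fun o : Γ.outputs => Pi.single (o : V) 1) fun x =>
        (∏ u ∈ Γ.outputsᶜ, measPhase (α u) (x u)) * ∏ e ∈ Γ.graph.edgeFinset, pairSign e x := by
  ext y a
  rw [OpenGraph.patternMap, Matrix.smul_apply, pathSum, Matrix.of_apply, Matrix.mul_apply,
    smul_eq_mul, Finset.mul_sum]
  refine Finset.sum_congr rfl fun x _ => ?_
  have h1 : (Γ.project α * Γ.entangle) y x = Γ.project α y x *
      ∏ e ∈ Γ.graph.edgeFinset, pairSign e x := by
    rw [OpenGraph.entangle, Matrix.mul_diagonal]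
    refine congrArg _ (Finset.prod_congr rfl fun e _ => ?_)
    rw [pairSign]
    congr
  have h2 : linAct (Matrix.of fun o : Γ.outputs => (Pi.single (o : V) 1 : V → ZMod 2)) x = y ↔
      ∀ o : Γ.outputs, x o = y o := by
    rw [funext_iff]
    refine forall_congr' fun o => ?_
    rw [linAct_of, ev_single]
  rw [h1, OpenGraph.project, OpenGraph.prepare, Matrix.of_apply, Matrix.of_apply]
  simp only [h2, conj_ketPlus, ketPlus_zero, Finset.prod_mul_distrib, Finset.prod_const]
  by_cases c1 : ∀ o : Γ.outputs, x o = y o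
  · by_cases c2 : ∀ i : Γ.inputs, x i = a i
    · rw [if_pos c1, if_pos c2, if_pos ⟨c1, c2⟩]
      ring
    · have c3 : ¬ ((∀ o : Γ.outputs, x o = y o) ∧ ∀ i : Γ.inputs, x i = a i) := fun hh => c2 hh.2
      rw [if_neg c2, if_neg c3, mul_zero, mul_zero]
  · have c3 : ¬ ((∀ o : Γ.outputs, x o = y o) ∧ ∀ i : Γ.inputs, x i = a i) := fun hh => c1 hh.1
    rw [if_neg c1, if_neg c3, zero_mul, zero_mul, mul_zero]

end Ends

end MBQC

namespace MBQC

/-! ### The circuit of a gflow -/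

section Circuit

variable {V : Type*} [Fintype V] [DecidableEq V] {Γ : OpenGraph V} {g : V → Finset V}
  {lev : V → ℕ}

theorem jLayerMatrix_eq_one {W : Type*} [Fintype W] [DecidableEq W] {jl : W → Option ℝ}
    (h : ∀ w, jl w = none) : jLayerMatrix jl = 1 := by
  obtain rfl : jl = fun _ => none := funext h
  ext b a
  simp only [jLayerMatrix, Matrix.of_apply, Matrix.one_apply, Finset.prod_ite_zero,
    Finset.prod_const_one, funext_iff, Finset.mem_univ, true_imp_iff]

theorem prod_ofFn_mul_eq {n m : Type*} [Fintype n] [DecidableEq n] {d : ℕ}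
    (A : Fin d → Matrix n n ℂ) (T : ℕ → Matrix n m ℂ) (h : ∀ k : Fin d, A k * T (k + 1) = T k) :
    (List.ofFn A).prod * T d = T 0 := by
  induction d generalizing T with
  | zero => simp
  | succ d ih =>
    have h1 := ih (fun k => A k.succ) (fun k => T (k + 1)) fun k => h k.succ
    rw [List.ofFn_succ, List.prod_cons, Matrix.mul_assoc, h1]
    exact h 0

omit [Fintype V] [DecidableEq V] in
theorem PathCover.card_inputs_le (P : PathCover Γ) : Γ.inputs.card ≤ Γ.outputs.card := by
  have := Finset.card_le_card_of_injOn (t := Finset.univ) P.wire (by simp) P.wire_injOn_inputs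
  simpa using this

/-- The constant of `feed` times `√2` for each of the `n` J gates gives `1 / √2` for each non-input.
-/
theorem inv_sqrt_two_pow_eq {o i v n : ℕ} (hio : i ≤ o) (hv : n + o = v) :
    (1 / (√2 : ℝ) : ℂ) ^ (o - i) * (2 ^ o / 2 ^ v) * ((√2 : ℝ) : ℂ) ^ n =
      (1 / (√2 : ℝ) : ℂ) ^ (v - i) := by
  have h2 : ((√2 : ℝ) : ℂ) * (√2 : ℝ) = 2 := by
    rw [← Complex.ofReal_mul, Real.mul_self_sqrt (by norm_num)]; norm_num
  have h0 : ((√2 : ℝ) : ℂ) ≠ 0 := by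
    intro h; rw [h] at h2; norm_num at h2
  obtain ⟨m, rfl⟩ := Nat.exists_eq_add_of_le hio
  subst hv
  rw [show n + (i + m) - i = m + n by omega, Nat.add_sub_cancel_left, pow_add _ m n, mul_assoc]
  congr 1
  have hn : (2 : ℂ) ^ n = ((√2 : ℝ) : ℂ) ^ n * ((√2 : ℝ) : ℂ) ^ n := by rw [← mul_pow, h2]
  rw [pow_add _ n, hn, one_div, inv_pow]
  field_simp

theorem OpenGraph.IsLevelled.exists_clifford (h : Γ.IsLevelled g lev) (P : PathCover Γ)
    (hP : ∀ v, v ∉ Γ.outputs → lev (P.succ v) < lev v) {d : ℕ} (hd : ∀ v, lev v ≤ d) :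
    ∃ cliff : Fin (d + 1) → List (CliffordGate Γ.outputs), ∀ C : LayeredCircuit Γ.outputs d,
      C.clifford = cliff → ∀ α : V → ℝ,
      (∀ k w θ, C.jLayer k w = some θ ↔ ∃ v, lev v = k + 1 ∧ P.wire v = w ∧ α v = θ) →
      Γ.patternMap α = (1 / (√2 : ℝ) : ℂ) ^ (Γ.outputsᶜ).card • (C.matrix * P.feed) := by
  classical
  have hwire : ∀ k, Set.InjOn P.wire (levelSet lev k) := fun k u hu v hv huv =>
    P.wire_injOn_level hP k (by simpa using hu) (by simpa using hv) huv
  choose κ hκ hκ' hliβ hliγ using fun k => h.exists_level_family k (hwire (k + 1))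
  obtain ⟨ι, hι, hliι⟩ := h.exists_input_family P.wire_injOn_inputs hd
  -- `κ k` is shared by `β (k + 1)` and, below the depth, `γ k`. The truncated index at `k = 0` is
  -- harmless: every wire carries an output there, so `κ` is never used.
  let β : ℕ → Γ.outputs → V → ZMod 2 := fun k =>
    glue (levelSet lev k) P.wire (fun v => Pi.single v 1) (κ (k - 1))
  let γ : ℕ → Γ.outputs → V → ZMod 2 := fun k =>
    if k = d then glue Γ.inputs P.wire (fun v => Pi.single v 1) ι
    else glue (levelSet lev (k + 1)) P.wire (Γ.lowerNbhd lev) (κ k)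
  have hout : ∀ o : Γ.outputs, (o : V) ∈ levelSet lev 0 ∧ P.wire o = o := fun o =>
    ⟨by rw [mem_levelSet, h.eq_zero_iff]; exact o.2, P.wire_output o⟩
  have hβ0 : ∀ o, β 0 o = Pi.single (o : V) 1 := by
    intro o
    have := glue_wire (hwire 0) (fun v => (Pi.single v 1 : V → ZMod 2)) (κ (0 - 1)) (hout o).1
    rwa [(hout o).2] at this
  have hβli : ∀ k, LinearIndependent (ZMod 2) (β k) := by
    intro k
    cases k with
    | succ k => exact hliβ k
    | zero =>
      have : IsEmpty {w : Γ.outputs // ∀ v ∈ levelSet lev 0, P.wire v ≠ w} :=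
        ⟨fun w => w.2 _ (hout w.1).1 (hout w.1).2⟩
      exact linearIndependent_glue (hwire 0) (single_dual _)
        (fun w hw => absurd (hout w).2 (hw _ (hout w).1)) linearIndependent_empty_type
  have hβmem : ∀ k w, β k w ∈ invariantForms Γ g lev k := by
    intro k
    refine glue_cases _ _ (p := (· ∈ invariantForms Γ g lev k)) (h.single_level_mem k)
      fun w hw => ?_
    cases k with
    | succ k => exact hκ' k w
    | zero => exact absurd (hout w).2 (hw _ (hout w).1)
  have hγli : ∀ k, LinearIndependent (ZMod 2) (γ k) := by
    intro k
    simp only [γ]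
    split_ifs
    · exact hliι
    · exact hliγ k
  have hγmem : ∀ k w, γ k w ∈ invariantForms Γ g lev k := by
    intro k w
    simp only [γ]
    split_ifs with hk
    · subst hk
      exact glue_cases _ _ (p := (· ∈ invariantForms Γ g lev k)) (h.single_input_mem hd)
        (fun w _ => hι w) w
    · exact glue_cases _ _ (p := (· ∈ invariantForms Γ g lev k)) (h.lowerNbhd_mem k)
        (fun w _ => hκ k w) w
  choose G hG hGβ using fun k => exists_change_of_basis
    ((h.finrank_invariantForms k).trans (Fintype.card_coe _).symm) (hβli k) (hγli k) (hβmem k)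
    (hγmem k)
  choose cnots hcnots using fun k => exists_cnot_circuit (G k) (hG k)
  choose czs hczs using fun k => exists_cz_circuit P.wire (levelEdges Γ lev k) (by
    intro u v huv
    rw [mk_mem_levelEdges] at huv
    exact fun e => huv.1.ne (hwire k (by simpa using huv.2.1) (by simpa using huv.2.2) e))
  -- The CNOT gates act first and bring the coordinates of the level-`k` vertices to their wires,
  -- where the CZ gates can read them.
  have hstep : ∀ k f, ((czs k ++ cnots k).map CliffordGate.matrix).prod *
      pathSum Γ.inputs (γ k) f = pathSum Γ.inputs (β k) fun x =>
        (∏ e ∈ levelEdges Γ lev k, pairSign e x) * f x := by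
    intro k f
    have hb : (fun w => ∑ w', G k w w' • γ k w') = β k := funext fun w => (hGβ k w).symm
    rw [List.map_append, List.prod_append, hczs, hcnots, Matrix.mul_assoc, basisMap_mul_pathSum,
      hb, diagonal_mul_pathSum]
    congr 1
    funext x
    congr 1
    refine Finset.prod_congr rfl fun e he => ?_
    have hx : ∀ v ∈ levelSet lev k, (linAct (Matrix.of (β k)) x ∘ P.wire) v = x v := by
      intro v hv
      have hβv : β k (P.wire v) = Pi.single v 1 := glue_wire (hwire k) _ _ hv
      rw [Function.comp_apply, linAct_of, hβv, ev_single]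
    induction e using Sym2.ind with
    | _ u v =>
      rw [mk_mem_levelEdges] at he
      rw [pairSign_mk, pairSign_mk, hx u (mem_levelSet.2 he.2.1), hx v (mem_levelSet.2 he.2.2)]
  -- All Clifford gates are fixed before the angles enter.
  refine ⟨fun k => czs k ++ cnots k, fun C hC α hJ => ?_⟩
  set c : ℂ := (1 / (√2 : ℝ) : ℂ) ^ (Γ.outputs.card - Γ.inputs.card) *
      (2 ^ Γ.outputs.card / 2 ^ Fintype.card V) with hc
  let N : ℕ → ℕ := fun k => (Finset.univ.filter fun v => k < lev v).card
  have hN : ∀ k, N k = N (k + 1) + (levelSet lev (k + 1)).card := by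
    intro k
    rw [← Finset.card_union_of_disjoint]
    · refine congrArg Finset.card ?_
      ext v
      simp only [Finset.mem_filter, Finset.mem_univ, true_and, Finset.mem_union, mem_levelSet]
      omega
    · refine Finset.disjoint_left.2 fun v h1 h2 => ?_
      simp only [Finset.mem_filter, Finset.mem_univ, true_and, mem_levelSet] at h1 h2
      omega
  -- `T k` is the state once the factors with indices `d, …, k` have acted, and `T (d + 1)` is the
  -- fed input. `N k` counts the J gates used so far.
  let T : ℕ → Matrix (Bits Γ.outputs) (Bits Γ.inputs) ℂ := fun k =>
    if k = d + 1 then P.feed else (c * ((√2 : ℝ) : ℂ) ^ N k) • pathSum Γ.inputs (β k) fun x =>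
      vertexPhase Γ lev α k x * edgePhase Γ lev d k x
  have hT : ∀ k : Fin (d + 1), (((C.clifford k).map CliffordGate.matrix).prod *
      jLayerMatrix (C.jLayer k)) * T (k + 1) = T k := by
    intro k
    have hk : (k : ℕ) ≤ d := Nat.lt_succ_iff.1 k.2
    have hTk : T k = (c * ((√2 : ℝ) : ℂ) ^ N k) • pathSum Γ.inputs (β k) fun x =>
      vertexPhase Γ lev α k x * edgePhase Γ lev d k x := if_neg (by omega)
    rw [hTk, Matrix.mul_assoc, hC]
    rcases hk.eq_or_lt with hkd | hkd
    · have hnone : ∀ w, C.jLayer k w = none := by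
        intro w
        rw [Option.eq_none_iff_forall_ne_some]
        intro θ hθ
        obtain ⟨v, hv, -⟩ := (hJ k w θ).1 hθ
        have := hd v
        omega
      have hempty : (Finset.univ.filter fun v => (k : ℕ) < lev v) = ∅ :=
        Finset.filter_eq_empty_iff.2 fun v _ => by have := hd v; omega
      have hγk : γ k = glue Γ.inputs P.wire (fun v => Pi.single v 1) ι := if_pos hkd
      have hTk1 : T (k + 1) = P.feed := if_pos (by omega)
      rw [jLayerMatrix_eq_one hnone, Matrix.one_mul, hTk1, P.feed_eq_pathSum hliι, ← hγk,
        Matrix.mul_smul, hstep]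
      have hNk : N k = 0 := by simp only [N, hempty, Finset.card_empty]
      rw [hNk, pow_zero, mul_one]
      congr 2
      funext x
      rw [vertexPhase, hempty, Finset.prod_empty, one_mul, edgePhase_eq_mul hk, edgePhase, hkd,
        Finset.Ico_self, Finset.prod_empty]
    · have hTk1 : T (k + 1) = (c * ((√2 : ℝ) : ℂ) ^ N (k + 1)) •
        pathSum Γ.inputs (β (k + 1)) fun x =>
          vertexPhase Γ lev α (k + 1) x * edgePhase Γ lev d (k + 1) x := if_neg (by omega)
      have hγk : γ k = glue (levelSet lev (k + 1)) P.wire (Γ.lowerNbhd lev) (κ k) :=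
        if_neg hkd.ne
      have hJk := jLayerMatrix_mul_pathSum (I := Γ.inputs) (hwire (k + 1)) (α := α)
        (jl := C.jLayer k)
        (fun v hv => (hJ k _ _).2 ⟨v, mem_levelSet.1 hv, rfl, rfl⟩)
        (fun w hw => by
          rw [Option.eq_none_iff_forall_ne_some]
          intro θ hθ
          obtain ⟨v, hv, hvw, -⟩ := (hJ k w θ).1 hθ
          exact hw v (mem_levelSet.2 hv) hvw)
        (κ := κ k) (h.indVec_dual k)
        (fun w u hu => by
          rw [mem_levelSet] at hu
          exact (mem_invariantForms.1 (hκ' k w)).2 u (h.not_output hu) hu.le)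
        (fun u hu v hv => by
          rw [mem_levelSet] at hu hv
          refine if_neg fun hvu => ?_
          have := h.lt_of_mem u (h.not_output hu) v hvu
          omega)
        (fun u hu i hi => if_neg fun hiu =>
          h.not_input u (h.not_output (mem_levelSet.1 hu)) i hiu hi)
        (h := fun x => vertexPhase Γ lev α (k + 1) x * edgePhase Γ lev d (k + 1) x)
        (fun u hu x => by
          rw [mem_levelSet] at hu
          rw [h.vertexPhase_shift α (h.not_output hu) hu.le,
            h.edgePhase_shift (h.not_output hu) hu.le])
      have hβk : β (k + 1) =
        glue (levelSet lev (k + 1)) P.wire (fun v => Pi.single v 1) (κ k) := rfl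
      rw [hTk1, Matrix.mul_smul, hβk, hJk, ← hγk, Matrix.mul_smul, Matrix.mul_smul, hstep,
        smul_smul, hN k, pow_add, ← mul_assoc]
      congr 2
      funext x
      rw [vertexPhase_eq_mul α k, edgePhase_eq_mul hk]
      ring
  have hfeed : P.feed = T (d + 1) := (if_pos rfl).symm
  have hT0 : T 0 = (c * ((√2 : ℝ) : ℂ) ^ N 0) • pathSum Γ.inputs (β 0) fun x =>
      vertexPhase Γ lev α 0 x * edgePhase Γ lev d 0 x := if_neg (by omega)
  have hO : (Finset.univ.filter fun v => 0 < lev v) = Γ.outputsᶜ := by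
    ext v
    simp [← h.eq_zero_iff, Nat.pos_iff_ne_zero]
  have hN0 : N 0 = Γ.outputsᶜ.card := congrArg Finset.card hO
  have hconst := inv_sqrt_two_pow_eq P.card_inputs_le (Finset.card_compl_add_card Γ.outputs)
  rw [hfeed, LayeredCircuit.matrix, prod_ofFn_mul_eq _ T hT, hT0, Γ.patternMap_eq_pathSum,
    smul_smul, hN0, hc, hconst, ← Finset.card_compl]
  congr 2
  · exact funext fun o => (hβ0 o).symm
  · funext x
    rw [prod_pairSign_edgeFinset hd, vertexPhase, edgePhase, hO, Finset.prod_mul_distrib,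
      ← mul_assoc]
    congr 2
    -- Outputs have level `0`, so their lower neighbourhoods are empty and contribute no sign.
    symm
    refine Finset.prod_subset (Finset.subset_univ _) fun v _ hv => ?_
    have hv0 : lev v = 0 := by
      rw [h.eq_zero_iff]
      simpa using hv
    rw [czSign_lowerNbhd]
    refine Finset.prod_eq_one fun w hw => ?_
    simp [hv0] at hw

open Classical in
theorem LayeredCircuit.depth_eq {W : Type*} {d : ℕ} (C : LayeredCircuit W d)
    (hlast : ∀ w, C.jLayer (Fin.last d) w = none) (c : ℕ) :
    C.depth c = c * (d + 1) +
      (Finset.univ.filter fun k : Fin d => ∃ w θ, C.jLayer k.castSucc w = some θ).card := by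
  rw [LayeredCircuit.depth, Finset.sum_add_distrib, Fin.sum_univ_castSucc (n := d)
    (f := fun k => if ∃ w θ, C.jLayer k w = some θ then 1 else 0)]
  simp [hlast, mul_comm]

end Circuit

end MBQC

theorem mainTheorem5 {V : Type*} [Fintype V] [DecidableEq V]
    (Γ : MBQC.OpenGraph V) (g : V → Finset V) (r : V → V → Prop) (hgr : Γ.IsGflow g r) :
    ∃ (P : MBQC.PathCover Γ)
      (cliff : Fin (MBQC.depth r + 1) → List (MBQC.CliffordGate Γ.outputs)),
      Function.Injective (fun i : Γ.inputs => P.wire i) ∧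
      (∀ k : ℕ, Set.InjOn P.wire {v | v ∈ MBQC.layer r k ∧ v ∉ Γ.outputs}) ∧
      ∀ α : V → ℝ, ∃ C : MBQC.LayeredCircuit Γ.outputs (MBQC.depth r),
        C.clifford = cliff ∧
        (∀ (k : Fin (MBQC.depth r + 1)) (w : Γ.outputs) (θ : ℝ), C.jLayer k w = some θ ↔
          ∃ v ∈ MBQC.layer r (k.val + 1), v ∉ Γ.outputs ∧ P.wire v = w ∧ α v = θ) ∧
        (∀ w : Γ.outputs, C.jLayer (Fin.last (MBQC.depth r)) w = none) ∧
        C.matrix ∈ Matrix.unitaryGroup (MBQC.Bits Γ.outputs) ℂ ∧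
        Γ.patternMap α =
          (1 / (√2 : ℝ) : ℂ) ^ (Γ.outputsᶜ).card • (C.matrix * P.feed) ∧
        (∀ c : ℕ, C.depth c ≤ c * (MBQC.depth r + 1) + MBQC.depth r) ∧
        (Γ.IsMaximallyDelayed g r →
          ∀ c : ℕ, C.depth c = c * (MBQC.depth r + 1) + MBQC.depth r) := by
  classical
  obtain ⟨lev, h, hd, hlev⟩ := hgr.exists_isLevelled
  obtain ⟨P, hP⟩ := h.exists_pathCover
  obtain ⟨cliff, hcliff⟩ := h.exists_clifford P hP hd
  have hwire := P.wire_injOn_level hP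
  refine ⟨P, cliff, fun i j hij => Subtype.ext (P.wire_injOn_inputs i.2 j.2 hij), ?_, ?_⟩
  · intro k
    cases k with
    | succ k => exact (hwire (k + 1)).mono fun v hv => (hlev k v).2 hv
    -- Layer `0` contains no non-outputs, as these have positive level.
    | zero =>
      rintro v ⟨hv, hvO⟩
      obtain ⟨k, hk⟩ := Nat.exists_eq_succ_of_ne_zero (mt (h.eq_zero_iff v).1 hvO)
      have := MBQC.eq_of_mem_layer hv ((hlev k v).1 hk).1
      omega
  · intro α
    let jl : Fin (MBQC.depth r + 1) → Γ.outputs → Option ℝ := fun k w =>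
      if hw : ∃ v, lev v = k + 1 ∧ P.wire v = w then some (α hw.choose) else none
    have hjl : ∀ k w θ, jl k w = some θ ↔ ∃ v, lev v = k + 1 ∧ P.wire v = w ∧ α v = θ := by
      intro k w θ
      by_cases hw : ∃ v, lev v = k + 1 ∧ P.wire v = w
      · have hj : jl k w = some (α hw.choose) := dif_pos hw
        rw [hj, Option.some_inj]
        constructor
        · rintro rfl
          exact ⟨_, hw.choose_spec.1, hw.choose_spec.2, rfl⟩
        · rintro ⟨v, hv, hvw, rfl⟩
          rw [hwire _ hw.choose_spec.1 hv (hw.choose_spec.2.trans hvw.symm)]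
      · have hj : jl k w = none := dif_neg hw
        rw [hj]
        constructor
        · intro e
          cases e
        · rintro ⟨v, hv, hvw, -⟩
          exact absurd ⟨v, hv, hvw⟩ hw
    have hlast : ∀ w, jl (Fin.last _) w = none := by
      intro w
      rw [Option.eq_none_iff_forall_ne_some]
      intro θ hθ
      obtain ⟨v, hv, -⟩ := (hjl _ w θ).1 hθ
      have := hd v
      rw [Fin.val_last] at hv
      omega
    refine ⟨⟨cliff, jl⟩, rfl, ?_, hlast, MBQC.LayeredCircuit.matrix_mem_unitaryGroup _,
      hcliff ⟨cliff, jl⟩ rfl α hjl, ?_, ?_⟩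
    · intro k w θ
      rw [hjl]
      simp only [hlev, and_assoc]
    · intro c
      rw [MBQC.LayeredCircuit.depth_eq _ hlast]
      exact Nat.add_le_add_left ((Finset.card_le_univ _).trans (Fintype.card_fin _).le) _
    · intro hmax c
      have hk : ∀ k : Fin (MBQC.depth r), ∃ w θ, jl k.castSucc w = some θ := by
        intro k
        -- An empty level below or at the depth could be closed up, against minimality.
        have hv : ∃ v, lev v = k + 1 := by
          by_contra! hskip
          obtain ⟨r', hr', hlt⟩ := h.exists_isGflow_depth_lt hd k.2 hskip
          exact absurd (hmax.2 g r' hr') (not_le.2 hlt)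
        obtain ⟨v, hv⟩ := hv
        exact ⟨P.wire v, α v, (hjl _ _ _).2 ⟨v, hv, rfl, rfl⟩⟩
      rw [MBQC.LayeredCircuit.depth_eq _ hlast]
      simp [hk]
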